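/- Let $\mathcal X,\mathcal Y$ be real Hilbert spaces, $K:\mathcal X\to\mathcal Y$ bounded linear, $F\in\Gamma_0(\mathcal Y)$ and $\bar G,H\in\Gamma_0(\mathcal X)$, where $\Gamma_0$ denotes the proper lower semicontinuous convex functions with values in $(-\infty,+\infty]$. Consider the problem $$\min_{x\in\mathcal X}\;F(Kx)+\bar G(x)+H(x). \tag{1.4}$$ Assume that its infimum is attained and that, with $Dx=(x,Kx)$, $$0\in\operatorname{ri}\bigl(\operatorname{dom}\bar G\times\operatorname{dom}F-D(\operatorname{dom}H)\bigr),$$ where in infinite dimension $\operatorname{ri}$ is the strong relative interior ($0\in\operatorname{sri}C$ iff $0\in C$ and $\bigcup_{t>0}tC$ is the closure of $\operatorname{span}C$; for convex $C$ in finite dimension this is the usual relative interior). Let $\Sigma,\Upsilon:\mathcal X\to\mathcal X$ and $\tilde T:\mathcal Y\to\mathcal Y$ be bounded, self-adjoint and positive definite (in the sense $\langle Sx,x\rangle\ge c\|x\|^2$ for some $c>0$). Write $f^*$ for the Legendre–Fenchel conjugate and $$\operatorname{prox}_{Sf}(w)=\operatorname*{arg\,min}_u\; f(u)+\tfrac12\langle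 S^{-1}(u-w),u-w\rangle .$$ Given arbitrary $x^0,x^1,y^0,y^1\in\mathcal X$ and $v^0,v^1\in\mathcal Y$, the preconditioned inertial primal-dual fixed point algorithm (IPDFP$^2$) iterates, for $k\ge1$, $$\begin{aligned} &\xi^k=x^k+\alpha_k(x^k-x^{k-1}),\quad \eta^k=y^k+\alpha_k(y^k-y^{k-1}),\quad \nu^k=v^k+\alpha_k(v^k-v^{k-1}),\\ &\tilde x^{k+1}=\operatorname{prox}_{\Sigma H}(\xi^k-\Sigma\eta^k-\Sigma K^*\nu^k),\\ &\tilde y^{k+1}=\operatorname{prox}_{\Upsilon\bar G^*}\bigl(\eta^k+\Upsilon(2\tilde x^{k+1}-\xi^k)\bigr),\\ &\tilde v^{k+1}=\operatorname{prox}_{\tilde TF^*}\bigl(\nu^k+\tilde TK(2\tilde x^{k+1}-\xi^k)\bigr),\\ &(x^{k+1},y^{k+1},v^{k+1})=\rho_k(\tilde x^{k+1},\tilde y^{k+1},\tilde v^{k+1})+(1-\rho_k)(\xi^k,\eta^k,\nu^k). \end{aligned}$$ **Theorem 4.1.** Suppose that (i) $\|\Sigma^{1/2}\Upsilon^{1/2}\|^2+\|\Sigma^{1/2}K^*\tilde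 T^{1/2}\|^2<1$; (ii) $(\alpha_k)_{k\ge1}$ is nondecreasing, $\alpha_1=0$, $0\le\alpha_k\le\alpha<1$ for all $k\ge1$, and $\rho,\theta,\hat\delta>0$ are such that $$\hat\delta>\frac{\alpha^2(1+\alpha)+\alpha\theta}{1-\alpha^2},\qquad 0<\rho\le\rho_k<\frac{\hat\delta-\alpha[\alpha(1+\alpha)+\alpha\hat\delta+\theta]}{\hat\delta[1+\alpha(1+\alpha)+\alpha\hat\delta+\theta]}\quad\text{for all }k\ge1 .$$ Then the sequence $(x^k)$ converges to a solution of Problem (1.4): it converges weakly, and in norm if $\mathcal X$ is finite-dimensional. -/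

import Mathlib

open Filter Topology
open scoped InnerProductSpace

noncomputable section

namespace IPDFP

/-! ### Convex functions with values in the extended reals -/

/-- The effective domain `{x | f x < +∞}`. -/
def dom {E : Type*} (f : E → EReal) : Set E := {x | f x ≠ ⊤}

/-- The class `Γ₀(E)` of proper lower semicontinuous convex functions `E → (-∞, +∞]`.
Convexity is convexity of the epigraph. -/
structure GammaZero {E : Type*} [NormedAddCommGroup E] [InnerProductSpace ℝ E]
    (f : E → EReal) : Prop where
  ne_bot : ∀ x, f x ≠ ⊥
  dom_nonempty : (dom f).Nonempty
  lsc : LowerSemicontinuous f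
  convex_epigraph : Convex ℝ {p : E × ℝ | f p.1 ≤ (p.2 : EReal)}

/-- The Legendre–Fenchel transform `f*(u) = sup_x (⟪x, u⟫ - f x)`. -/
def fenchelConj {E : Type*} [NormedAddCommGroup E] [InnerProductSpace ℝ E]
    (f : E → EReal) (u : E) : EReal :=
  ⨆ x : E, ((⟪x, u⟫_ℝ : ℝ) : EReal) - f x

/-- The strong relative interior of `C`: the points `x ∈ C` such that the cone generated by
`C - x` is the closure of the linear span of `C - x`.  For a convex subset of a
finite-dimensional space this is the usual relative interior. -/
def strongRelInterior {E : Type*} [NormedAddCommGroup E] [NormedSpace ℝ E]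
    (C : Set E) : Set E :=
  {x | x ∈ C ∧ {z | ∃ t : ℝ, 0 < t ∧ ∃ c ∈ C, z = t • (c - x)} =
    closure (Submodule.span ℝ ((fun c => c - x) '' C) : Set E)}

/-! ### Self-adjoint positive definite operators and their square roots -/

/-- Self-adjoint positive definite bounded operators of a Hilbert space (with a bounded inverse:
the quadratic form is bounded below by a positive multiple of the square of the norm).
In finite dimension this just says `0 < ⟪S x, x⟫` for `x ≠ 0`. -/
structure PosDef {E : Type*} [NormedAddCommGroup E] [InnerProductSpace ℝ E] [CompleteSpace E]
    (S : E →L[ℝ] E) : Prop where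
  selfAdjoint : IsSelfAdjoint S
  coercive : ∃ c : ℝ, 0 < c ∧ ∀ x, c * ‖x‖ ^ 2 ≤ ⟪S x, x⟫_ℝ

theorem PosDef.exists_sqrt {E : Type*} [NormedAddCommGroup E] [InnerProductSpace ℝ E]
    [CompleteSpace E] {S : E →L[ℝ] E} (hS : PosDef S) :
    ∃ R : E →L[ℝ] E, R.IsPositive ∧ R ∘L R = S := by
  obtain ⟨hsa, c, hc, hcS⟩ := hS
  obtain ⟨M, hM, hMl⟩ : ∃ M : ℝ, 0 < M ∧ ‖S‖ ^ 2 + 1 ≤ M * c :=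
    ⟨(‖S‖ ^ 2 + 1) / c, by positivity, by field_simp; exact le_refl _⟩
  set A : E →L[ℝ] E := 1 - M⁻¹ • S with hA
  have hAsa : IsSelfAdjoint A := by
    rw [hA]
    exact (IsSelfAdjoint.one _).sub (IsSelfAdjoint.smul (IsSelfAdjoint.all _) hsa)
  have hAnorm : ‖A‖ ≤ √(1 - M⁻¹ * c) := by
    refine ContinuousLinearMap.opNorm_le_bound _ (Real.sqrt_nonneg _) fun x => ?_
    have h1 : ‖A x‖ ^ 2 ≤ (1 - M⁻¹ * c) * ‖x‖ ^ 2 := by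
      have h2 : A x = x - M⁻¹ • S x := by simp [hA]
      rw [h2, norm_sub_sq_real, inner_smul_right, norm_smul, real_inner_comm,
        Real.norm_of_nonneg (inv_nonneg.2 hM.le)]
      have h3 : ‖S x‖ ^ 2 ≤ ‖S‖ ^ 2 * ‖x‖ ^ 2 := by
        rw [← mul_pow]
        exact pow_le_pow_left₀ (norm_nonneg _) (S.le_opNorm x) 2
      have h4 := hcS x
      have h5 : 0 < M⁻¹ := inv_pos.2 hM
      have h6 : M⁻¹ * ‖S‖ ^ 2 ≤ c := by
        rw [inv_mul_le_iff₀ hM]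
        linarith
      have h7 : M⁻¹ * (M⁻¹ * ‖S x‖ ^ 2) ≤ M⁻¹ * (c * ‖x‖ ^ 2) := by
        refine mul_le_mul_of_nonneg_left ?_ h5.le
        calc M⁻¹ * ‖S x‖ ^ 2 ≤ M⁻¹ * (‖S‖ ^ 2 * ‖x‖ ^ 2) :=
              mul_le_mul_of_nonneg_left h3 h5.le
          _ = (M⁻¹ * ‖S‖ ^ 2) * ‖x‖ ^ 2 := by ring
          _ ≤ c * ‖x‖ ^ 2 := mul_le_mul_of_nonneg_right h6 (sq_nonneg _)
      have h8 := mul_le_mul_of_nonneg_left h4 h5.le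
      nlinarith
    rw [← Real.sqrt_sq (norm_nonneg (A x)), ← Real.sqrt_sq (norm_nonneg x),
      ← Real.sqrt_mul' _ (sq_nonneg _)]
    exact Real.sqrt_le_sqrt h1
  have hA1 : ‖A‖ < 1 := by
    refine hAnorm.trans_lt ?_
    rw [Real.sqrt_lt' one_pos]
    have : 0 < M⁻¹ * c := by positivity
    linarith
  set r : ℝ := 1 - √(1 - ‖A‖) with hr
  have hs0 : 0 < √(1 - ‖A‖) := Real.sqrt_pos.2 (by linarith)
  have hs1 : √(1 - ‖A‖) ≤ 1 := Real.sqrt_le_one.2 (by linarith [norm_nonneg A])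
  have hsq : √(1 - ‖A‖) ^ 2 = 1 - ‖A‖ := Real.sq_sqrt (by linarith)
  have hr0 : 0 ≤ r := by linarith
  have hr1 : r < 1 := by linarith
  have hrr : ‖A‖ + r ^ 2 = 2 * r := by rw [hr]; nlinarith
  let f : (E →L[ℝ] E) → (E →L[ℝ] E) := fun Z => (1 / 2 : ℝ) • (A + Z * Z)
  let s : Set (E →L[ℝ] E) := {Z | IsSelfAdjoint Z} ∩ Metric.closedBall 0 r
  have hsc : IsComplete s := by
    refine IsClosed.isComplete (IsClosed.inter ?_ Metric.isClosed_closedBall)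
    exact isClosed_eq continuous_star continuous_id
  have hmaps : Set.MapsTo f s s := by
    rintro Z ⟨hZ, hZr⟩
    rw [mem_closedBall_zero_iff] at hZr
    have hZ' : IsSelfAdjoint Z := hZ
    refine ⟨?_, ?_⟩
    · exact IsSelfAdjoint.smul (IsSelfAdjoint.all _)
        (hAsa.add ((IsSelfAdjoint.commute_iff hZ' hZ').1 (Commute.refl Z)))
    · rw [mem_closedBall_zero_iff]
      have h1 : ‖A + Z * Z‖ ≤ ‖A‖ + ‖Z‖ * ‖Z‖ :=
        (norm_add_le _ _).trans (add_le_add le_rfl (norm_mul_le _ _))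
      have h2 : ‖Z‖ * ‖Z‖ ≤ r * r := mul_le_mul hZr hZr (norm_nonneg _) hr0
      change ‖(1 / 2 : ℝ) • (A + Z * Z)‖ ≤ r
      rw [norm_smul, Real.norm_of_nonneg (by norm_num)]
      nlinarith
  have hcontr : ContractingWith ⟨r, hr0⟩ (hmaps.restrict f s s) := by
    refine ⟨by exact_mod_cast hr1, LipschitzWith.of_dist_le_mul ?_⟩
    rintro ⟨Z, hZ, hZr⟩ ⟨W, hW, hWr⟩
    rw [mem_closedBall_zero_iff] at hZr hWr
    change dist (f Z) (f W) ≤ r * dist Z W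
    rw [dist_eq_norm, dist_eq_norm]
    have h1 : f Z - f W = (1 / 2 : ℝ) • (Z * (Z - W) + (Z - W) * W) := by
      change (1 / 2 : ℝ) • (A + Z * Z) - (1 / 2 : ℝ) • (A + W * W) = _
      rw [← smul_sub]
      congr 1
      noncomm_ring
    rw [h1, norm_smul, Real.norm_of_nonneg (by norm_num)]
    have h2 : ‖Z * (Z - W) + (Z - W) * W‖ ≤ ‖Z‖ * ‖Z - W‖ + ‖Z - W‖ * ‖W‖ :=
      (norm_add_le _ _).trans (add_le_add (norm_mul_le _ _) (norm_mul_le _ _))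
    have h3 := mul_le_mul_of_nonneg_right hZr (norm_nonneg (Z - W))
    have h4 := mul_le_mul_of_nonneg_left hWr (norm_nonneg (Z - W))
    nlinarith
  have h0 : (0 : E →L[ℝ] E) ∈ s := ⟨IsSelfAdjoint.zero _, by simpa using hr0⟩
  obtain ⟨Z, ⟨hZ, hZr⟩, hfix, -⟩ :=
    hcontr.exists_fixedPoint' hsc hmaps h0 (edist_ne_top _ _)
  rw [mem_closedBall_zero_iff] at hZr
  have hZ' : IsSelfAdjoint Z := hZ
  have hfix' : (1 / 2 : ℝ) • (A + Z * Z) = Z := hfix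
  refine ⟨√M • (1 - Z), ?_, ?_⟩
  · rw [ContinuousLinearMap.isPositive_def']
    refine ⟨IsSelfAdjoint.smul (IsSelfAdjoint.all _) ((IsSelfAdjoint.one _).sub hZ'),
      fun x => ?_⟩
    have h1 : ⟪Z x, x⟫_ℝ ≤ ‖x‖ * ‖x‖ := by
      refine (real_inner_le_norm _ _).trans
        (mul_le_mul_of_nonneg_right ?_ (norm_nonneg _))
      refine (Z.le_opNorm x).trans ?_
      nlinarith [norm_nonneg x]
    rw [ContinuousLinearMap.reApplyInnerSelf_apply]
    have h2 : (√M • (1 - Z)) x = √M • (x - Z x) := by simp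
    rw [h2, real_inner_smul_left, inner_sub_left, real_inner_self_eq_norm_mul_norm]
    exact mul_nonneg (Real.sqrt_nonneg _) (by linarith)
  · change (√M • (1 - Z)) * (√M • (1 - Z)) = S
    rw [smul_mul_smul_comm, Real.mul_self_sqrt hM.le]
    have h1 : Z * Z = (2 : ℝ) • Z - A := by
      nth_rewrite 3 [← hfix']
      rw [smul_smul]
      norm_num
    have h2 : (1 - Z) * (1 - Z) = 1 - (2 : ℝ) • Z + Z * Z := by
      rw [two_smul]
      noncomm_ring
    rw [h2, h1, hA]
    have h3 : (1 : E →L[ℝ] E) - (2 : ℝ) • Z + ((2 : ℝ) • Z - (1 - M⁻¹ • S)) = M⁻¹ • S := by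
      abel
    rw [h3, smul_smul, mul_inv_cancel₀ hM.ne', one_smul]

/-- The positive square root `S^{1/2}`. -/
def PosDef.sqrt {E : Type*} [NormedAddCommGroup E] [InnerProductSpace ℝ E]
    [CompleteSpace E] {S : E →L[ℝ] E} (hS : PosDef S) : E →L[ℝ] E :=
  hS.exists_sqrt.choose

/-! ### Proximity operators -/

/-- `p` minimizes `u ↦ f u + ½ ⟪S⁻¹ (u - w), u - w⟫`. -/
def IsProx {E : Type*} [NormedAddCommGroup E] [InnerProductSpace ℝ E] [CompleteSpace E]
    (S : E →L[ℝ] E) (f : E → EReal) (w p : E) : Prop :=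
  ∀ u, f p + ((1 / 2 * ⟪Ring.inverse S (p - w), p - w⟫_ℝ : ℝ) : EReal) ≤
    f u + ((1 / 2 * ⟪Ring.inverse S (u - w), u - w⟫_ℝ : ℝ) : EReal)

/-- The proximity operator `prox_{S f}`, that is `(I + S ∂f)⁻¹`: the point `prox S f w` is the
minimizer of `u ↦ f u + ½ ⟪S⁻¹ (u - w), u - w⟫`, which exists and is unique for positive
definite `S` and `f ∈ Γ₀(E)`. -/
def prox {E : Type*} [NormedAddCommGroup E] [InnerProductSpace ℝ E] [CompleteSpace E]
    (S : E →L[ℝ] E) (f : E → EReal) (w : E) : E :=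
  Classical.epsilon (IsProx S f w)

/-! ### The optimization problem -/

section Problem

variable {X Y : Type*} [NormedAddCommGroup X] [InnerProductSpace ℝ X]
  [NormedAddCommGroup Y] [InnerProductSpace ℝ Y]

/-- `x` is a solution of `min_x F (K x) + G x + H x`. -/
def IsSolution (K : X →L[ℝ] Y) (F : Y → EReal) (G H : X → EReal) (x : X) : Prop :=
  ∀ u, F (K x) + G x + H x ≤ F (K u) + G u + H u

/-- The qualification condition `0 ∈ ri (dom h - D (dom H))` of the problem
`min_x H x + h (D x)`, where `D x = (x, K x)` and `h (y, v) = G y + F v`. -/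
def Qualification (K : X →L[ℝ] Y) (F : Y → EReal) (G H : X → EReal) : Prop :=
  (0 : X × Y) ∈ strongRelInterior
    {p : X × Y | ∃ y ∈ dom G, ∃ v ∈ dom F, ∃ x ∈ dom H, p = (y - x, v - K x)}

end Problem

/-! ### The algorithm -/

/-- The sequences `(x k, y k, v k)` are generated, from the arbitrary initial points with indices
`0` and `1`, by the preconditioned inertial primal-dual fixed point iteration with positive
definite maps `S`, `U`, `T`, extrapolation parameters `α k` and relaxation parameters `ρ k`. -/
def Generated {X Y : Type*} [NormedAddCommGroup X] [InnerProductSpace ℝ X] [CompleteSpace X]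
    [NormedAddCommGroup Y] [InnerProductSpace ℝ Y] [CompleteSpace Y]
    (K : X →L[ℝ] Y) (F : Y → EReal) (G H : X → EReal)
    (S U : X →L[ℝ] X) (T : Y →L[ℝ] Y) (α ρ : ℕ → ℝ)
    (x y : ℕ → X) (v : ℕ → Y) : Prop :=
  ∀ k : ℕ, 1 ≤ k →
    let ξ := x k + α k • (x k - x (k - 1))
    let η := y k + α k • (y k - y (k - 1))
    let ν := v k + α k • (v k - v (k - 1))
    let x' := prox S H (ξ - S η - S (K.adjoint ν))
    let y' := prox U (fenchelConj G) (η + U ((2 : ℝ) • x' - ξ))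
    let v' := prox T (fenchelConj F) (ν + T (K ((2 : ℝ) • x' - ξ)))
    x (k + 1) = ρ k • x' + (1 - ρ k) • ξ ∧
    y (k + 1) = ρ k • y' + (1 - ρ k) • η ∧
    v (k + 1) = ρ k • v' + (1 - ρ k) • ν

/-- Weak convergence of a sequence in a Hilbert space. -/
def WeaklyConvergesTo {E : Type*} [NormedAddCommGroup E] [InnerProductSpace ℝ E]
    (x : ℕ → E) (a : E) : Prop :=
  ∀ w : E, Tendsto (fun k => ⟪x k, w⟫_ℝ) atTop (𝓝 ⟪a, w⟫_ℝ)

end IPDFP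

end

/-! The strong relative interior condition supplies multipliers: every solution `x` extends to a
triple `(x, y, v)` with `-y - K* v ∈ ∂H x`, `y ∈ ∂G x`, `v ∈ ∂F (K x)` (`exists_isKKT`). Such
triples are the zeros of the monotone operator `A (x, y, v) = (∂H x + y + K* v, ∂G* y - x, ∂F* v - K
x)`, and conversely each has a solution as its first component (`IsKKT.isSolution`).

Without inertia and relaxation, one step `z ↦ z'` of the algorithm is characterized by `M (z - z') ∈
A z'`, where `M` is the self-adjoint block operator `preconditioner` (`primalDualStep_eq_iff`). The
norm condition makes `M` positive definite (`posDef_preconditioner`), so the step is a resolvent in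
the metric of `M`: it is nonexpansive there, and its fixed points are the zeros of `A`.

The algorithm is thus an inertial Krasnosel'skii–Mann iteration, and conjugation by `M^{1/2}`
reduces it to the original norm (`PosDef.exists_weak_limit_inertial`). Its convergence rests on a
Lyapunov sequence (`tendsto_of_inertial_le`), which the parameter bounds make decreasing: distances
to fixed points converge and steps tend to zero. Demiclosedness and Opial's lemma then give one weak
limit. -/

namespace IPDFP

/-! ### Weak limits along filters -/

/-- A bounded family in a Hilbert space has a weak limit along every ultrafilter. -/
theorem exists_weak_limit {ι E : Type*} [NormedAddCommGroup E] [InnerProductSpace ℝ E]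
    [CompleteSpace E] (𝒰 : Ultrafilter ι) {x : ι → E} {C : ℝ} (hx : ∀ᶠ i in 𝒰, ‖x i‖ ≤ C) :
    ∃ a : E, ∀ w : E, Tendsto (fun i => ⟪x i, w⟫_ℝ) 𝒰 (𝓝 ⟪a, w⟫_ℝ) := by
  -- Each scalar family stays in a compact interval, so it converges along the ultrafilter.
  -- Uniqueness of limits makes `c` linear, and Riesz representation turns it into a vector.
  have h1 : ∀ w : E, ∃ c : ℝ, Tendsto (fun i => ⟪x i, w⟫_ℝ) 𝒰 (𝓝 c) ∧ ‖c‖ ≤ C * ‖w‖ := by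
    intro w
    have h2 : ((𝒰.map fun i => ⟪x i, w⟫_ℝ : Ultrafilter ℝ) : Filter ℝ) ≤
        𝓟 (Metric.closedBall 0 (C * ‖w‖)) := by
      rw [le_principal_iff, Ultrafilter.coe_map, mem_map]
      filter_upwards [hx] with i hi
      rw [Set.mem_preimage, mem_closedBall_zero_iff]
      exact (norm_inner_le_norm _ _).trans (mul_le_mul_of_nonneg_right hi (norm_nonneg _))
    obtain ⟨c, hc, hc'⟩ := (isCompact_closedBall (0 : ℝ) (C * ‖w‖)).ultrafilter_le_nhds _ h2
    exact ⟨c, hc', mem_closedBall_zero_iff.1 hc⟩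
  choose c hc hcb using h1
  let l : E →ₗ[ℝ] ℝ :=
    { toFun := c
      map_add' := fun w z => by
        refine tendsto_nhds_unique (hc (w + z)) ?_
        simpa only [inner_add_right] using (hc w).add (hc z)
      map_smul' := fun t w => by
        refine tendsto_nhds_unique (hc (t • w)) ?_
        simpa only [inner_smul_right, smul_eq_mul, RingHom.id_apply] using (hc w).const_mul t }
  let L : E →L[ℝ] ℝ := l.mkContinuous C hcb
  refine ⟨(InnerProductSpace.toDual ℝ E).symm L, fun w => ?_⟩
  rw [InnerProductSpace.toDual_symm_apply]
  exact hc w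

/-- A closed convex set contains the weak limits of its families. -/
theorem mem_of_weak_limit {ι E : Type*} [NormedAddCommGroup E] [NormedSpace ℝ E]
    {l : Filter ι} [l.NeBot] {C : Set E} (hC : Convex ℝ C) (hC' : IsClosed C) {x : ι → E} {a : E}
    (hx : ∀ᶠ i in l, x i ∈ C) (hxa : ∀ f : E →L[ℝ] ℝ, Tendsto (fun i => f (x i)) l (𝓝 (f a))) :
    a ∈ C := by
  by_contra ha
  obtain ⟨f, u, h1, h2⟩ := geometric_hahn_banach_point_closed hC hC' ha
  exact absurd (ge_of_tendsto (hxa f) (hx.mono fun i hi => (h2 _ hi).le)) (not_le.2 h1)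

theorem tendsto_clm_of_weak_limit {ι E : Type*} [NormedAddCommGroup E] [InnerProductSpace ℝ E]
    [CompleteSpace E] {l : Filter ι} {x : ι → E} {a : E}
    (h : ∀ w : E, Tendsto (fun i => ⟪x i, w⟫_ℝ) l (𝓝 ⟪a, w⟫_ℝ)) (f : E →L[ℝ] ℝ) :
    Tendsto (fun i => f (x i)) l (𝓝 (f a)) := by
  have h1 : ∀ z, f z = ⟪z, (InnerProductSpace.toDual ℝ E).symm f⟫_ℝ := fun z => by
    rw [real_inner_comm, InnerProductSpace.toDual_symm_apply]
  simp only [h1]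
  exact h _

/-! ### Closed convex functions -/

/-- Lower semicontinuous convex functions with values in `(-∞, +∞]` on a normed space. -/
structure IsClosedConvex {E : Type*} [NormedAddCommGroup E] [NormedSpace ℝ E]
    (f : E → EReal) : Prop where
  ne_bot : ∀ x, f x ≠ ⊥
  lsc : LowerSemicontinuous f
  convex_epigraph : Convex ℝ {p : E × ℝ | f p.1 ≤ (p.2 : EReal)}

theorem GammaZero.isClosedConvex {E : Type*} [NormedAddCommGroup E] [InnerProductSpace ℝ E]
    {f : E → EReal} (hf : GammaZero f) : IsClosedConvex f :=
  ⟨hf.ne_bot, hf.lsc, hf.convex_epigraph⟩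

theorem add_le_coe {a b : EReal} (ha : a ≠ ⊥) (hb : b ≠ ⊥) {t : ℝ} (h : a + b ≤ t) :
    ∃ r s : ℝ, a = r ∧ b = s ∧ r + s ≤ t := by
  have ha' : a ≠ ⊤ := by
    rintro rfl
    rw [EReal.top_add_of_ne_bot hb] at h
    exact EReal.coe_ne_top _ (top_le_iff.1 h)
  have hb' : b ≠ ⊤ := by
    rintro rfl
    rw [EReal.add_top_of_ne_bot ha] at h
    exact EReal.coe_ne_top _ (top_le_iff.1 h)
  lift a to ℝ using ⟨ha', ha⟩
  lift b to ℝ using ⟨hb', hb⟩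
  exact ⟨a, b, rfl, rfl, by exact_mod_cast h⟩

namespace IsClosedConvex

variable {E E' : Type*} [NormedAddCommGroup E] [NormedSpace ℝ E]
  [NormedAddCommGroup E'] [NormedSpace ℝ E'] {f g : E → EReal}

theorem le_combo (hf : IsClosedConvex f) {x y : E} {r s a b : ℝ} (hx : f x ≤ r) (hy : f y ≤ s)
    (ha : 0 ≤ a) (hb : 0 ≤ b) (hab : a + b = 1) :
    f (a • x + b • y) ≤ ((a * r + b * s : ℝ) : EReal) :=
  hf.convex_epigraph (x := (x, r)) hx (y := (y, s)) hy ha hb hab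

theorem add (hf : IsClosedConvex f) (hg : IsClosedConvex g) :
    IsClosedConvex fun x => f x + g x := by
  refine ⟨fun x => ?_, ?_, ?_⟩
  · rw [Ne, EReal.add_eq_bot_iff]
    exact not_or.2 ⟨hf.ne_bot x, hg.ne_bot x⟩
  · exact hf.lsc.add' hg.lsc fun x => EReal.continuousAt_add (.inr (hg.ne_bot x))
      (.inl (hf.ne_bot x))
  · rintro ⟨x, r⟩ hx ⟨y, s⟩ hy a b ha hb hab
    obtain ⟨r₁, r₂, h1, h2, h3⟩ := add_le_coe (hf.ne_bot x) (hg.ne_bot x) hx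
    obtain ⟨s₁, s₂, h4, h5, h6⟩ := add_le_coe (hf.ne_bot y) (hg.ne_bot y) hy
    refine (add_le_add (hf.le_combo h1.le h4.le ha hb hab)
      (hg.le_combo h2.le h5.le ha hb hab)).trans ?_
    change _ ≤ ((a * r + b * s : ℝ) : EReal)
    rw [← EReal.coe_add, EReal.coe_le_coe_iff]
    nlinarith [mul_le_mul_of_nonneg_left h3 ha, mul_le_mul_of_nonneg_left h6 hb]

theorem comp_clm {h : E' → EReal} (hh : IsClosedConvex h) (A : E →L[ℝ] E') :
    IsClosedConvex fun x => h (A x) := by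
  refine ⟨fun x => hh.ne_bot _, hh.lsc.comp A.continuous, ?_⟩
  rintro ⟨x, r⟩ hx ⟨y, s⟩ hy a b ha hb hab
  have := hh.le_combo hx hy ha hb hab
  change h (A (a • x + b • y)) ≤ _
  rwa [map_add, map_smul, map_smul]

theorem of_convexOn {q : E → ℝ} (hq : ConvexOn ℝ Set.univ q) (hc : Continuous q) :
    IsClosedConvex fun x => (q x : EReal) := by
  refine ⟨fun x => EReal.coe_ne_bot _,
    (continuous_coe_real_ereal.comp hc).lowerSemicontinuous, ?_⟩
  have := hq.convex_epigraph
  convert this using 1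
  ext p
  simp

theorem convex_sublevel (hf : IsClosedConvex f) (r : ℝ) : Convex ℝ {x | f x ≤ r} := by
  intro x hx y hy a b ha hb hab
  have := hf.le_combo hx hy ha hb hab
  rwa [← add_mul, hab, one_mul] at this

theorem isClosed_sublevel (hf : IsClosedConvex f) (r : ℝ) : IsClosed {x | f x ≤ r} :=
  hf.lsc.isClosed_preimage r

theorem isClosed_epigraph (hf : IsClosedConvex f) :
    IsClosed {p : E × ℝ | f p.1 ≤ (p.2 : EReal)} :=
  hf.lsc.isClosed_epigraph.preimage
    (continuous_fst.prodMk (continuous_coe_real_ereal.comp continuous_snd))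

/-- A proper closed convex function has a continuous affine minorant. -/
theorem exists_affine_minorant (hf : IsClosedConvex f) (hdom : (dom f).Nonempty) :
    ∃ (l : E →L[ℝ] ℝ) (b : ℝ), ∀ z (s : ℝ), f z ≤ s → l z + b ≤ s := by
  obtain ⟨x₀, hx₀⟩ := hdom
  obtain ⟨r₀, hr₀⟩ : ∃ r : ℝ, f x₀ = r :=
    ⟨(f x₀).toReal, (EReal.coe_toReal hx₀ (hf.ne_bot x₀)).symm⟩
  have hnot : (x₀, r₀ - 1) ∉ {p : E × ℝ | f p.1 ≤ (p.2 : EReal)} := by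
    simp only [Set.mem_ofPred_eq, hr₀, EReal.coe_le_coe_iff]
    linarith
  obtain ⟨φ, u, h1, h2⟩ := geometric_hahn_banach_point_closed hf.convex_epigraph
    hf.isClosed_epigraph hnot
  have hφ : ∀ (z : E) (s : ℝ), φ (z, s) = φ (z, 0) + s * φ (0, 1) := fun z s => by
    have : (z, s) = (z, 0) + s • ((0 : E), (1 : ℝ)) := by simp
    rw [this, map_add, map_smul, smul_eq_mul]
  set c := φ (0, 1) with hc
  -- The points `(x₀, r₀ - 1)` and `(x₀, r₀)` differ only vertically, so the separating hyperplane
  -- cannot be vertical.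
  have hc0 : 0 < c := by
    have h3 := h2 (x₀, r₀) hr₀.le
    rw [hφ] at h1 h3
    nlinarith
  refine ⟨-(c⁻¹ • φ.comp (ContinuousLinearMap.inl ℝ E ℝ)), c⁻¹ * u, fun z s hs => ?_⟩
  have h3 := h2 (z, s) hs
  rw [hφ] at h3
  have h4 : c⁻¹ * u < c⁻¹ * (φ (z, 0) + s * c) := mul_lt_mul_of_pos_left h3 (inv_pos.2 hc0)
  have h5 : c⁻¹ * (φ (z, 0) + s * c) = c⁻¹ * φ (z, 0) + s := by field_simp
  simp only [neg_apply, smul_apply,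
    ContinuousLinearMap.comp_apply, ContinuousLinearMap.inl_apply, smul_eq_mul]
  linarith

end IsClosedConvex

/-- A proper closed convex function with bounded sublevel sets attains its infimum. -/
theorem IsClosedConvex.exists_forall_le {E : Type*} [NormedAddCommGroup E]
    [InnerProductSpace ℝ E] [CompleteSpace E] {f : E → EReal} (hf : IsClosedConvex f)
    (hdom : (dom f).Nonempty) (hb : ∀ r : ℝ, ∃ C : ℝ, ∀ x, f x ≤ r → ‖x‖ ≤ C) :
    ∃ p, ∀ u, f p ≤ f u := by
  obtain ⟨x₀, hx₀⟩ := hdom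
  have hlt : ⨅ x, f x < ⊤ := (iInf_le f x₀).trans_lt (lt_top_iff_ne_top.2 hx₀)
  obtain ⟨t, -, ht, htm⟩ := exists_seq_tendsto_sInf (S := Set.range f) ⟨_, x₀, rfl⟩
    (OrderBot.bddBelow _)
  choose x hx using htm
  rw [sInf_range] at ht
  obtain ⟨r, hr, -⟩ := EReal.lt_iff_exists_real_btwn.1 hlt
  obtain ⟨C, hC⟩ := hb r
  have hev : ∀ s : ℝ, ⨅ x, f x < s → ∀ᶠ n in (hyperfilter ℕ : Filter ℕ), f (x n) ≤ s :=
    fun s hs => ((ht.eventually_lt_const hs).filter_mono Nat.hyperfilter_le_atTop).mono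
      fun n hn => (hx n).trans_le hn.le
  -- A weak limit of the minimizing sequence lies in every sublevel set above the infimum, since
  -- these sets are closed and convex.
  obtain ⟨p, hp⟩ := exists_weak_limit (hyperfilter ℕ) ((hev r hr).mono fun n hn => hC _ hn)
  refine ⟨p, fun u => le_trans ?_ (iInf_le f u)⟩
  rw [← EReal.le_of_forall_lt_iff_le]
  exact fun s hs => mem_of_weak_limit (hf.convex_sublevel s) (hf.isClosed_sublevel s) (hev s hs)
    (tendsto_clm_of_weak_limit hp)

/-! ### Positive definite operators -/

namespace PosDef

variable {E : Type*} [NormedAddCommGroup E] [InnerProductSpace ℝ E] [CompleteSpace E]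
  {S : E →L[ℝ] E}

theorem inner_map_comm (hS : PosDef S) (x y : E) : ⟪S x, y⟫_ℝ = ⟪x, S y⟫_ℝ :=
  hS.selfAdjoint.isSymmetric x y

theorem inner_nonneg (hS : PosDef S) (x : E) : 0 ≤ ⟪S x, x⟫_ℝ := by
  obtain ⟨c, hc, h⟩ := hS.coercive
  exact (by positivity : (0 : ℝ) ≤ c * ‖x‖ ^ 2).trans (h x)

theorem eq_zero_of_inner_nonpos (hS : PosDef S) {x : E} (hx : ⟪S x, x⟫_ℝ ≤ 0) : x = 0 := by
  obtain ⟨c, hc, h⟩ := hS.coercive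
  have h1 : ‖x‖ ^ 2 ≤ 0 := by nlinarith [h x]
  exact norm_eq_zero.1 (pow_eq_zero_iff two_ne_zero |>.1 (le_antisymm h1 (sq_nonneg _)))

theorem isUnit (hS : PosDef S) : IsUnit S := by
  obtain ⟨c, hc, h⟩ := hS.coercive
  refine ContinuousLinearMap.isUnit_of_forall_le_norm_inner_map S (c := ⟨c, hc.le⟩) hc fun x => ?_
  rw [mul_comm]
  exact (h x).trans (le_abs_self _)

theorem apply_inverse (hS : PosDef S) (x : E) : S (Ring.inverse S x) = x := by
  have := congrArg (fun A : E →L[ℝ] E => A x) (Ring.mul_inverse_cancel S hS.isUnit)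
  simpa using this

theorem inverse_apply (hS : PosDef S) (x : E) : Ring.inverse S (S x) = x := by
  have := congrArg (fun A : E →L[ℝ] E => A x) (Ring.inverse_mul_cancel S hS.isUnit)
  simpa using this

theorem inverse (hS : PosDef S) : PosDef (Ring.inverse S) := by
  refine ⟨?_, ?_⟩
  · rw [ContinuousLinearMap.isSelfAdjoint_iff_isSymmetric]
    intro x y
    change ⟪Ring.inverse S x, y⟫_ℝ = ⟪x, Ring.inverse S y⟫_ℝ
    conv_lhs => rw [← hS.apply_inverse y]
    conv_rhs => rw [← hS.apply_inverse x]
    exact (hS.inner_map_comm _ _).symm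
  · obtain ⟨c, hc, h⟩ := hS.coercive
    -- Coercivity of `S` at `S⁻¹ x` is compared with `‖x‖ ≤ ‖S‖ * ‖S⁻¹ x‖`; the `+ 1` keeps the
    -- denominator positive on the trivial space.
    refine ⟨c / (‖S‖ + 1) ^ 2, by positivity, fun x => ?_⟩
    have h1 := h (Ring.inverse S x)
    rw [hS.apply_inverse, real_inner_comm] at h1
    refine le_trans ?_ h1
    have h2 : ‖x‖ ≤ (‖S‖ + 1) * ‖Ring.inverse S x‖ := by
      conv_lhs => rw [← hS.apply_inverse x]
      refine (S.le_opNorm _).trans ?_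
      gcongr
      linarith
    rw [div_mul_eq_mul_div, mul_div_assoc]
    refine mul_le_mul_of_nonneg_left ?_ hc.le
    rw [div_le_iff₀ (by positivity)]
    calc ‖x‖ ^ 2 ≤ ((‖S‖ + 1) * ‖Ring.inverse S x‖) ^ 2 := by gcongr
      _ = _ := by ring

theorem id : PosDef (ContinuousLinearMap.id ℝ E) :=
  ⟨IsSelfAdjoint.one _, 1, one_pos, fun x => by simp⟩

theorem isClosedConvex_quadratic (hS : PosDef S) (w : E) :
    IsClosedConvex fun u => ((1 / 2 * ⟪S (u - w), u - w⟫_ℝ : ℝ) : EReal) := by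
  refine .of_convexOn ⟨convex_univ, ?_⟩ (by fun_prop)
  intro x _ y _ a b ha hb hab
  have h1 : a • x + b • y - w = a • (x - w) + b • (y - w) := by
    have : w = a • w + b • w := by rw [← add_smul, hab, one_smul]
    nth_rewrite 1 [this]
    simp only [smul_sub]
    abel
  -- The convexity defect of the quadratic is `a * b / 2` times the form at this difference.
  have h2 := hS.inner_nonneg ((x - w) - (y - w))
  have h3 : ⟪S (y - w), x - w⟫_ℝ = ⟪S (x - w), y - w⟫_ℝ := by
    rw [hS.inner_map_comm, real_inner_comm]
  rw [map_sub, inner_sub_left, inner_sub_right _ (x - w), inner_sub_right _ (x - w), h3] at h2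
  simp only [smul_eq_mul]
  rw [h1, map_add, map_smul, map_smul, inner_add_left, inner_add_right, inner_add_right]
  simp only [real_inner_smul_left, real_inner_smul_right]
  rw [h3]
  obtain rfl : b = 1 - a := by linarith
  nlinarith [mul_nonneg (mul_nonneg ha hb) h2]

end PosDef

/-! ### Subgradients -/

/-- `u` is a subgradient of `f` at `x`, and `f x` is finite. -/
def IsSubgradient {E : Type*} [NormedAddCommGroup E] [InnerProductSpace ℝ E]
    (f : E → EReal) (x u : E) : Prop :=
  ∃ r : ℝ, f x = r ∧ ∀ z (s : ℝ), f z ≤ s → r + ⟪u, z - x⟫_ℝ ≤ s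

section

variable {E : Type*} [NormedAddCommGroup E] [InnerProductSpace ℝ E] {f : E → EReal}

theorem IsSubgradient.monotone {x y u v : E} (hx : IsSubgradient f x u)
    (hy : IsSubgradient f y v) : 0 ≤ ⟪u - v, x - y⟫_ℝ := by
  obtain ⟨r, hr, h1⟩ := hx
  obtain ⟨s, hs, h2⟩ := hy
  have h3 := h1 y s hs.le
  have h4 := h2 x r hr.le
  rw [← neg_sub x y, inner_neg_right] at h3
  rw [inner_sub_left]
  linarith

/-- Reduces bounds on the conjugate to real inequalities over the epigraph of `f`, with no extended
subtraction left. -/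
theorem fenchelConj_le_coe_iff (hf : ∀ x, f x ≠ ⊥) {u : E} {s : ℝ} :
    fenchelConj f u ≤ s ↔ ∀ x (r : ℝ), f x ≤ r → ⟪x, u⟫_ℝ - r ≤ s := by
  rw [fenchelConj, iSup_le_iff]
  refine forall_congr' fun x => ?_
  rcases eq_or_ne (f x) ⊤ with h | h
  · simp only [h, EReal.sub_top, bot_le, true_iff]
    exact fun r hr => absurd (top_le_iff.1 hr) (EReal.coe_ne_top r)
  · obtain ⟨t, ht⟩ : ∃ t : ℝ, f x = t := ⟨_, (EReal.coe_toReal h (hf x)).symm⟩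
    rw [ht, ← EReal.coe_sub, EReal.coe_le_coe_iff]
    refine ⟨fun h1 r hr => ?_, fun h1 => h1 t le_rfl⟩
    rw [EReal.coe_le_coe_iff] at hr
    linarith

/-- A point where `f` is finite keeps the conjugate above `-∞`, and the slope of an affine minorant
is a point where it is finite. Lower semicontinuity and convexity come from its being a supremum of
affine functions. -/
theorem GammaZero.fenchelConj [CompleteSpace E] (hf : GammaZero f) :
    GammaZero (fenchelConj f) := by
  obtain ⟨x₀, hx₀⟩ := hf.dom_nonempty
  have hr₀ := EReal.coe_toReal hx₀ (hf.ne_bot x₀)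
  refine ⟨fun u h => ?_, ?_, ?_, ?_⟩
  · have h1 := (fenchelConj_le_coe_iff hf.ne_bot (s := ⟪x₀, u⟫_ℝ - (f x₀).toReal - 1)).1
      (h.trans_le bot_le) x₀ _ hr₀.ge
    linarith
  · obtain ⟨l, b, hl⟩ := hf.isClosedConvex.exists_affine_minorant hf.dom_nonempty
    refine ⟨(InnerProductSpace.toDual ℝ E).symm l, fun h => ?_⟩
    have h1 : IPDFP.fenchelConj f ((InnerProductSpace.toDual ℝ E).symm l) ≤ ((-b : ℝ) : EReal) := by
      refine (fenchelConj_le_coe_iff hf.ne_bot).2 fun x r hr => ?_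
      rw [real_inner_comm, InnerProductSpace.toDual_symm_apply]
      linarith [hl x r hr]
    rw [h] at h1
    exact EReal.coe_ne_top _ (top_le_iff.1 h1)
  · refine lowerSemicontinuous_iSup fun x => ?_
    rcases eq_or_ne (f x) ⊤ with h | h
    · simp only [h, EReal.sub_top]
      exact lowerSemicontinuous_const
    · rw [← EReal.coe_toReal h (hf.ne_bot x)]
      simp only [← EReal.coe_sub]
      exact (continuous_coe_real_ereal.comp (by fun_prop)).lowerSemicontinuous
  · rintro ⟨u, s⟩ hu ⟨v, t⟩ hv a b ha hb hab
    refine (fenchelConj_le_coe_iff hf.ne_bot).2 fun x r hr => ?_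
    have h1 := (fenchelConj_le_coe_iff hf.ne_bot).1 hu x r hr
    have h2 := (fenchelConj_le_coe_iff hf.ne_bot).1 hv x r hr
    simp only [Prod.fst_add, Prod.smul_fst, Prod.snd_add, Prod.smul_snd, smul_eq_mul,
      inner_add_right, real_inner_smul_right] at h1 h2 ⊢
    obtain rfl : b = 1 - a := by linarith
    nlinarith [mul_le_mul_of_nonneg_left h1 ha, mul_le_mul_of_nonneg_left h2 hb]

/-- The easy half of the inversion rule: the subgradient inequality says that `x` attains the
supremum defining the conjugate at `u`. Neither convexity nor closedness is needed. -/
theorem IsSubgradient.fenchelConj (hf : ∀ x, f x ≠ ⊥) {x u : E} (h : IsSubgradient f x u) :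
    IsSubgradient (fenchelConj f) u x := by
  obtain ⟨r, hr, h⟩ := h
  refine ⟨⟪x, u⟫_ℝ - r, le_antisymm ((fenchelConj_le_coe_iff hf).2 fun z s hs => ?_) ?_,
    fun v s hs => ?_⟩
  · have := h z s hs
    rw [inner_sub_right, real_inner_comm, real_inner_comm x] at this
    linarith
  · refine le_trans ?_ (le_iSup _ x)
    rw [hr, EReal.coe_sub]
  · have := (fenchelConj_le_coe_iff hf).1 hs x r hr.le
    rw [inner_sub_right]
    linarith

end

/-! ### Proximity operators -/

section

variable {E : Type*} [NormedAddCommGroup E] [InnerProductSpace ℝ E] [CompleteSpace E]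
  {S : E →L[ℝ] E} {f : E → EReal}

theorem exists_isProx (hS : PosDef S) (hf : GammaZero f) (w : E) : ∃ p, IsProx S f w p := by
  have hq := hS.inverse.isClosedConvex_quadratic w
  refine (hf.isClosedConvex.add hq).exists_forall_le ?_ fun r => ?_
  · obtain ⟨x, hx⟩ := hf.dom_nonempty
    exact ⟨x, EReal.add_ne_top hx (EReal.coe_ne_top _)⟩
  · obtain ⟨l, b, hl⟩ := hf.isClosedConvex.exists_affine_minorant hf.dom_nonempty
    obtain ⟨c, hc, hcS⟩ := hS.inverse.coercive
    set D := |r - b + ‖l‖ * ‖w‖| with hD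
    -- With `m = ‖u - w‖`, the affine minorant and coercivity give `c / 2 * m ^ 2 ≤ D + ‖l‖ * m`.
    -- For `m > 1` the right side is at most `(‖l‖ + D) * m`; the `+ 1` covers `m ≤ 1`.
    refine ⟨2 * (‖l‖ + D) / c + 1 + ‖w‖, fun u hu => ?_⟩
    obtain ⟨r₁, r₂, h1, h2, h3⟩ := add_le_coe (hf.ne_bot u) (hq.ne_bot u) hu
    have h2' := EReal.coe_eq_coe_iff.1 h2
    have h4 := hl u r₁ h1.le
    have h5 := hcS (u - w)
    have h6 : ‖u‖ ≤ ‖u - w‖ + ‖w‖ := by simpa using norm_add_le (u - w) w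
    have h7 : -(‖l‖ * ‖u‖) ≤ l u := (abs_le.1 (l.le_opNorm u)).1
    have h8 := mul_le_mul_of_nonneg_left h6 (norm_nonneg l)
    have h9 : r - b + ‖l‖ * ‖w‖ ≤ D := le_abs_self _
    have h10 : 0 ≤ D := abs_nonneg _
    have hm : ‖u - w‖ ≤ 2 * (‖l‖ + D) / c + 1 := by
      by_contra! hcon
      have h11 : 2 * (‖l‖ + D) < c * (‖u - w‖ - 1) := by
        rw [← div_lt_iff₀' hc]
        linarith
      have h12 : 1 < ‖u - w‖ := by
        have : 0 ≤ 2 * (‖l‖ + D) / c := by positivity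
        linarith
      have h13 := mul_lt_mul_of_pos_right h11 (by linarith : 0 < ‖u - w‖)
      nlinarith [mul_nonneg h10 (by linarith : 0 ≤ ‖u - w‖ - 1), mul_pos hc (by linarith : 0 < ‖u - w‖)]
    linarith

theorem IsProx.isSubgradient (hS : PosDef S) (hf : GammaZero f) {w p : E} (hp : IsProx S f w p) :
    IsSubgradient f p (Ring.inverse S (w - p)) := by
  have hB := hS.inverse
  set B := Ring.inverse S with hBdef
  have hfin : f p ≠ ⊤ := by
    intro h
    obtain ⟨x, hx⟩ := hf.dom_nonempty
    have := hp x
    rw [h, EReal.top_add_coe, top_le_iff] at this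
    exact EReal.add_ne_top hx (EReal.coe_ne_top _) this
  obtain ⟨r, hr⟩ : ∃ r : ℝ, f p = r := ⟨_, (EReal.coe_toReal hfin (hf.ne_bot p)).symm⟩
  refine ⟨r, hr, fun z s hs => ?_⟩
  -- Fermat's rule: compare `p` with the point at parameter `t` of the segment to `z`, divide by
  -- `t`, and let `t` tend to zero.
  have key : ∀ t : ℝ, 0 < t → t < 1 →
      0 ≤ (s - r) + ⟪B (p - w), z - p⟫_ℝ + t * (1 / 2 * ⟪B (z - p), z - p⟫_ℝ) := by
    intro t ht0 ht1
    have h1 := hf.isClosedConvex.le_combo hr.le hs (by linarith : 0 ≤ 1 - t) ht0.le (by ring)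
    have h2 := (hp ((1 - t) • p + t • z)).trans (add_le_add_left h1 _)
    rw [hr, ← EReal.coe_add, ← EReal.coe_add, EReal.coe_le_coe_iff] at h2
    have h3 : (1 - t) • p + t • z - w = (p - w) + t • (z - p) := by module
    have h4 : ⟪B (z - p), p - w⟫_ℝ = ⟪B (p - w), z - p⟫_ℝ := by
      rw [hB.inner_map_comm, real_inner_comm]
    rw [h3, map_add, map_smul, inner_add_left, inner_add_right, inner_add_right] at h2
    simp only [real_inner_smul_left, real_inner_smul_right] at h2
    rw [h4] at h2
    have h5 : 0 ≤ t * ((s - r) + ⟪B (p - w), z - p⟫_ℝ + t * (1 / 2 * ⟪B (z - p), z - p⟫_ℝ)) := by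
      linarith
    exact nonneg_of_mul_nonneg_right h5 ht0
  have hlim : Tendsto (fun t : ℝ => (s - r) + ⟪B (p - w), z - p⟫_ℝ +
      t * (1 / 2 * ⟪B (z - p), z - p⟫_ℝ)) (𝓝[>] 0) (𝓝 ((s - r) + ⟪B (p - w), z - p⟫_ℝ +
      0 * (1 / 2 * ⟪B (z - p), z - p⟫_ℝ))) :=
    ((continuous_const.add (continuous_id.mul continuous_const)).tendsto 0).mono_left
      nhdsWithin_le_nhds
  have h0 := ge_of_tendsto hlim (by
    filter_upwards [Ioo_mem_nhdsGT (zero_lt_one' ℝ)] with t ht using key t ht.1 ht.2)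
  rw [← neg_sub p w, map_neg, inner_neg_left]
  linarith

theorem IsSubgradient.eq_of_posDef {B : E →L[ℝ] E} (hB : PosDef B) {w p q : E}
    (hp : IsSubgradient f p (B (w - p))) (hq : IsSubgradient f q (B (w - q))) : p = q := by
  have h := hp.monotone hq
  rw [← map_sub, sub_sub_sub_cancel_left, ← neg_sub p q, map_neg, inner_neg_left] at h
  exact sub_eq_zero.1 (hB.eq_zero_of_inner_nonpos (by linarith))

theorem isSubgradient_prox (hS : PosDef S) (hf : GammaZero f) (w : E) :
    IsSubgradient f (prox S f w) (Ring.inverse S (w - prox S f w)) :=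
  IsProx.isSubgradient hS hf (Classical.epsilon_spec (exists_isProx hS hf w))

theorem prox_eq_iff (hS : PosDef S) (hf : GammaZero f) {w p : E} :
    prox S f w = p ↔ IsSubgradient f p (Ring.inverse S (w - p)) := by
  refine ⟨?_, fun h => (isSubgradient_prox hS hf w).eq_of_posDef hS.inverse h⟩
  rintro rfl
  exact isSubgradient_prox hS hf w

/-- The subdifferential of the conjugate is the inverse of the subdifferential. -/
theorem isSubgradient_fenchelConj_iff (hf : GammaZero f) {x u : E} :
    IsSubgradient (fenchelConj f) u x ↔ IsSubgradient f x u := by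
  refine ⟨fun h => ?_, fun h => h.fenchelConj hf.ne_bot⟩
  -- Minty's trick in place of biconjugation: `x + u - p` is a subgradient of `f` at `p`, and
  -- monotonicity of the conjugate's subdifferential yields `0 ≤ -‖x - p‖ ^ 2`, so `p = x`.
  have hp := isSubgradient_prox PosDef.id hf (x + u)
  set p := prox (ContinuousLinearMap.id ℝ E) f (x + u) with hpdef
  have h1 : Ring.inverse (ContinuousLinearMap.id ℝ E) (x + u - p) = x + u - p :=
    PosDef.id.inverse_apply _
  rw [h1] at hp
  have h2 := h.monotone (hp.fenchelConj hf.ne_bot)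
  have h3 : u - (x + u - p) = -(x - p) := by abel
  rw [h3, inner_neg_right, real_inner_self_eq_norm_sq] at h2
  have h4 : x = p := sub_eq_zero.1 (norm_eq_zero.1 (pow_eq_zero_iff two_ne_zero |>.1
    (le_antisymm (by linarith) (sq_nonneg ‖x - p‖))))
  rwa [← h4, add_sub_cancel_left] at hp

end

/-! ### Duality under the strong relative interior condition -/

section

variable {X W : Type*} [NormedAddCommGroup X] [NormedAddCommGroup W] [NormedSpace ℝ W] {Φ : X × W → EReal}

/-- The perturbations in `V` for which a point of norm at most `r` has value at most `r`. -/
def boundedSublevel (Φ : X × W → EReal) (V : Submodule ℝ W) (r : ℝ) : Set V :=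
  {p | ∃ x : X, ‖x‖ ≤ r ∧ Φ (x, (p : W)) ≤ r}

theorem boundedSublevel_mono (V : Submodule ℝ W) {r s : ℝ} (h : r ≤ s) :
    boundedSublevel Φ V r ⊆ boundedSublevel Φ V s := by
  rintro p ⟨x, h1, h2⟩
  exact ⟨x, h1.trans h, h2.trans (EReal.coe_le_coe_iff.2 h)⟩

variable [InnerProductSpace ℝ X]

theorem IsClosedConvex.convex_boundedSublevel (hΦ : IsClosedConvex Φ) (V : Submodule ℝ W) (r : ℝ) :
    Convex ℝ (boundedSublevel Φ V r) := by
  rintro p ⟨x, h1, h2⟩ q ⟨y, h3, h4⟩ a b ha hb hab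
  refine ⟨a • x + b • y, ?_, hΦ.convex_sublevel r h2 h4 ha hb hab⟩
  have := convex_closedBall (0 : X) r (mem_closedBall_zero_iff.2 h1)
    (mem_closedBall_zero_iff.2 h3) ha hb hab
  exact mem_closedBall_zero_iff.1 this

/-- The bound on `‖x‖` is what makes this projection closed: the witnesses have a weak limit, and
the pairs (witness, perturbation) converge weakly to a point of the closed convex sublevel set. -/
theorem IsClosedConvex.isClosed_boundedSublevel [CompleteSpace X] (hΦ : IsClosedConvex Φ)
    (V : Submodule ℝ W) (r : ℝ) : IsClosed (boundedSublevel Φ V r) := by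
  rw [isClosed_iff_ultrafilter]
  intro p 𝒰 hp hmem
  have hex : ∀ q : V, ∃ x : X, q ∈ boundedSublevel Φ V r → ‖x‖ ≤ r ∧ Φ (x, (q : W)) ≤ r := by
    intro q
    by_cases hq : q ∈ boundedSublevel Φ V r
    · obtain ⟨x, hx⟩ := hq
      exact ⟨x, fun _ => hx⟩
    · exact ⟨0, fun h => absurd h hq⟩
  choose x hx using hex
  have hev : ∀ᶠ q in (𝒰 : Filter V), q ∈ boundedSublevel Φ V r := hmem
  obtain ⟨a, ha⟩ := exists_weak_limit 𝒰 (hev.mono fun q hq => (hx q hq).1)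
  have ha' := tendsto_clm_of_weak_limit ha
  have hcoe : Tendsto (fun q : V => (q : W)) 𝒰 (𝓝 (p : W)) :=
    (continuous_subtype_val.tendsto p).mono_left hp
  refine ⟨a, ?_, ?_⟩
  · have := mem_of_weak_limit (convex_closedBall (0 : X) r) Metric.isClosed_closedBall
      (hev.mono fun q hq => mem_closedBall_zero_iff.2 (hx q hq).1) ha'
    exact mem_closedBall_zero_iff.1 this
  · refine mem_of_weak_limit (x := fun q : V => (x q, (q : W))) (a := (a, (p : W)))
      (hΦ.convex_sublevel r) (hΦ.isClosed_sublevel r)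
      (hev.mono fun q hq => (hx q hq).2) fun f => ?_
    have hf : ∀ (z : X) (w : W), f (z, w) =
        f.comp (ContinuousLinearMap.inl ℝ X W) z + f.comp (ContinuousLinearMap.inr ℝ X W) w := by
      intro z w
      simp [← map_add]
    simp only [hf]
    exact (ha' _).add (((ContinuousLinearMap.continuous _).tendsto _).comp hcoe)

/-- If `0` is in the strong relative interior of the set of the feasible perturbations, then the
value function is bounded above near `0`. -/
theorem IsClosedConvex.exists_ball_subset_boundedSublevel [CompleteSpace X] [CompleteSpace W]
    (hΦ : IsClosedConvex Φ)
    (hri : (0 : W) ∈ strongRelInterior {p | ∃ x, Φ (x, p) ≠ ⊤}) :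
    ∃ V : Submodule ℝ W, {p | ∃ x, Φ (x, p) ≠ ⊤} ⊆ V ∧
      ∃ N ε : ℝ, 0 < ε ∧ ∀ p : V, ‖p‖ < ε → p ∈ boundedSublevel Φ V N := by
  set C : Set W := {p | ∃ x, Φ (x, p) ≠ ⊤} with hC
  obtain ⟨h0, hcone⟩ := hri
  simp only [sub_zero, Set.image_id'] at hcone
  set V : Submodule ℝ W := (Submodule.span ℝ C).topologicalClosure with hV
  have hVcl : IsClosed (V : Set W) := Submodule.isClosed_topologicalClosure _
  have hCV : C ⊆ V := Submodule.subset_span.trans subset_closure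
  have : CompleteSpace V := hVcl.completeSpace_coe
  have hex : ∀ p : V, (p : W) ∈ C → ∃ r : ℝ, p ∈ boundedSublevel Φ V r := by
    rintro p ⟨x, hx⟩
    refine ⟨max ‖x‖ (Φ (x, p)).toReal, x, le_max_left _ _, ?_⟩
    rw [← EReal.coe_toReal hx (hΦ.ne_bot _), EReal.toReal_coe, EReal.coe_le_coe_iff]
    exact le_max_right _ _
  obtain ⟨r₀, hr₀⟩ := hex 0 h0
  -- The sublevel sets are absorbing: the cone generated by `C` is all of `V`, so `v = t • c`, and
  -- for large `R` the point `R⁻¹ • v` is a convex combination of `c` and `0`.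
  have habs : ∀ v : V, ∃ R : ℝ, 0 < R ∧ r₀ ≤ R ∧ R⁻¹ • v ∈ boundedSublevel Φ V R := by
    intro v
    obtain ⟨t, ht, c, hc, hvc⟩ : (v : W) ∈ {z | ∃ t : ℝ, 0 < t ∧ ∃ c ∈ C, z = t • c} := by
      rw [hcone]
      exact v.2
    obtain ⟨r, hr⟩ := hex ⟨c, hCV hc⟩ hc
    have hR : 0 < max t (max r r₀) := lt_max_of_lt_left ht
    refine ⟨max t (max r r₀), hR, le_max_of_le_right (le_max_right _ _), ?_⟩
    have hv : v = t • (⟨c, hCV hc⟩ : V) := Subtype.ext hvc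
    rw [hv, smul_smul]
    have h1 : (max t (max r r₀))⁻¹ * t ≤ 1 := by
      rw [inv_mul_le_iff₀ hR, mul_one]
      exact le_max_left _ _
    have h2 := hΦ.convex_boundedSublevel V (max t (max r r₀))
      (boundedSublevel_mono V (le_max_of_le_right (le_max_left _ _)) hr)
      (boundedSublevel_mono V (le_max_of_le_right (le_max_right _ _)) hr₀)
      (by positivity : 0 ≤ (max t (max r r₀))⁻¹ * t) (sub_nonneg.2 h1) (by ring)
    rwa [smul_zero, add_zero] at h2
  have hmono : ∀ (v : V) (R R' : ℝ), 0 < R → r₀ ≤ R → R ≤ R' →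
      R⁻¹ • v ∈ boundedSublevel Φ V R → R'⁻¹ • v ∈ boundedSublevel Φ V R' := by
    intro v R R' hR hr hRR' hv
    have hR' := hR.trans_le hRR'
    have h1 : R'⁻¹ * R ≤ 1 := by
      rwa [inv_mul_le_iff₀ hR', mul_one]
    have h2 := hΦ.convex_boundedSublevel V R' (boundedSublevel_mono V hRR' hv)
      (boundedSublevel_mono V (hr.trans hRR') hr₀)
      (by positivity : 0 ≤ R'⁻¹ * R) (sub_nonneg.2 h1) (by ring)
    rwa [smul_zero, add_zero, smul_smul, mul_assoc, mul_inv_cancel₀ hR.ne', mul_one] at h2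
  obtain ⟨n₀, hn₀⟩ := exists_nat_gt (max 0 r₀)
  have hn₀' : ∀ n : ℕ, 0 < (n : ℝ) + n₀ ∧ r₀ ≤ (n : ℝ) + n₀ := fun n => by
    have h1 := max_lt_iff.1 hn₀
    have h2 : (0 : ℝ) ≤ n := n.cast_nonneg
    constructor <;> linarith
  -- Baire's theorem in the complete space `V`. The offset `n₀` keeps every scale positive and at
  -- least `r₀`.
  obtain ⟨n, v₀, hv₀⟩ := nonempty_interior_of_iUnion_of_closed
    (f := fun n : ℕ => {v : V | ((n : ℝ) + n₀)⁻¹ • v ∈ boundedSublevel Φ V ((n : ℝ) + n₀)})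
    (fun n => (hΦ.isClosed_boundedSublevel V _).preimage (by fun_prop)) (by
      refine Set.eq_univ_of_forall fun v => ?_
      obtain ⟨R, hR, hRr, hv⟩ := habs v
      obtain ⟨n, hn⟩ := exists_nat_gt R
      exact Set.mem_iUnion.2 ⟨n, hmono v R _ hR hRr
        (hn.le.trans (le_add_of_nonneg_right n₀.cast_nonneg)) hv⟩)
  obtain ⟨ρ, hρ, hball⟩ := Metric.isOpen_iff.1 isOpen_interior v₀ hv₀
  obtain ⟨R, hR, hRr, hv⟩ := habs (-v₀)
  set N : ℝ := max ((n : ℝ) + n₀) R with hN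
  have hN0 : 0 < N := lt_max_of_lt_right hR
  -- The ball around `v₀` is recentred at `0`: `p` is the midpoint of `N⁻¹ • (v₀ + (2 * N) • p)` and
  -- `N⁻¹ • (-v₀)`.
  refine ⟨V, hCV, N, ρ / (2 * N), by positivity, fun p hp => ?_⟩
  have h1 : v₀ + (2 * N) • p ∈ Metric.ball v₀ ρ := by
    rw [mem_ball_iff_norm, add_sub_cancel_left, norm_smul, Real.norm_of_nonneg (by positivity)]
    rwa [lt_div_iff₀' (by positivity)] at hp
  have h2 := hmono _ _ N (hn₀' n).1 (hn₀' n).2 (le_max_left _ _) (show _ ∈ {v : V | ((n : ℝ) + n₀)⁻¹ • v ∈ boundedSublevel Φ V ((n : ℝ) + n₀)} from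
    interior_subset (hball h1))
  have h3 := hmono _ _ N hR hRr (le_max_right _ _) hv
  have h4 := hΦ.convex_boundedSublevel V N h2 h3 (by norm_num : (0 : ℝ) ≤ 1 / 2)
    (by norm_num : (0 : ℝ) ≤ 1 / 2) (by norm_num)
  have h5 : (1 / 2 : ℝ) • N⁻¹ • (v₀ + (2 * N) • p) + (1 / 2 : ℝ) • N⁻¹ • (-v₀) = p := by
    rw [← smul_add, ← smul_add, add_neg_cancel_comm, smul_smul, smul_smul,
      show 1 / 2 * N⁻¹ * (2 * N) = 1 by field_simp, one_smul]
  rwa [h5] at h4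

/-- Existence of a Lagrange multiplier under the strong relative interior condition. -/
theorem IsClosedConvex.exists_multiplier [CompleteSpace X] [CompleteSpace W]
    (hΦ : IsClosedConvex Φ) {μ : ℝ} (hmin : ∀ (x : X) (s : ℝ), Φ (x, 0) ≤ s → μ ≤ s)
    (hri : (0 : W) ∈ strongRelInterior {p | ∃ x, Φ (x, p) ≠ ⊤}) :
    ∃ l : W →L[ℝ] ℝ, ∀ (x : X) (p : W) (s : ℝ), Φ (x, p) ≤ s → μ + l p ≤ s := by
  obtain ⟨V, hCV, N, ε, hε, hball⟩ := hΦ.exists_ball_subset_boundedSublevel hri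
  have hμN : μ ≤ N := by
    obtain ⟨x, -, hx⟩ := hball 0 (by simpa using hε)
    exact hmin x N hx
  -- The strict epigraph of the value function, taken over `V` so that it has interior points; the
  -- multiplier is the slope of a hyperplane supporting it at `(0, μ)`.
  let E : Set (V × ℝ) := {q | ∃ (x : X) (s : ℝ), s < q.2 ∧ Φ (x, (q.1 : W)) ≤ s}
  have hE : Convex ℝ E := by
    rintro ⟨p, r⟩ ⟨x, s, hs, hx⟩ ⟨q, r'⟩ ⟨y, s', hs', hy⟩ a b ha hb hab
    refine ⟨a • x + b • y, a * s + b * s', ?_, hΦ.le_combo hx hy ha hb hab⟩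
    change a * s + b * s' < a * r + b * r'
    rcases ha.eq_or_lt with rfl | ha'
    · obtain rfl : b = 1 := by linarith
      simpa using hs'
    · have h1 := mul_lt_mul_of_pos_left hs ha'
      have h2 := mul_le_mul_of_nonneg_left hs'.le hb
      linarith
  have h0E : ((0 : V), μ) ∉ E := by
    rintro ⟨x, s, hs, hx⟩
    exact absurd (hmin x s hx) (not_le.2 hs)
  have hint : ((0 : V), N + 1) ∈ interior E := by
    refine mem_interior.2 ⟨Metric.ball (0 : V) ε ×ˢ Set.Ioi N, ?_,
      Metric.isOpen_ball.prod isOpen_Ioi, ?_⟩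
    · rintro ⟨p, r⟩ ⟨hp, hr⟩
      obtain ⟨x, -, hx⟩ := hball p (mem_ball_zero_iff.1 hp)
      exact ⟨x, N, hr, hx⟩
    · exact ⟨Metric.mem_ball_self hε, by simp⟩
  obtain ⟨f, hf⟩ := geometric_hahn_banach_open_point hE.interior isOpen_interior
    fun h => h0E (interior_subset h)
  have hfE : ∀ q ∈ E, f q ≤ f (0, μ) := by
    intro q hq
    have hq' : q ∈ closure (interior E) := by
      rw [hE.closure_interior_eq_closure_of_nonempty_interior ⟨_, hint⟩]
      exact subset_closure hq
    exact closure_minimal (fun a ha => (hf a ha).le) (isClosed_le f.continuous continuous_const) hq'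
  set c := f (0, 1) with hc
  have hfc : ∀ (p : V) (s : ℝ), f (p, s) = f (p, 0) + s * c := fun p s => by
    have : (p, s) = (p, 0) + s • ((0 : V), (1 : ℝ)) := by simp
    rw [this, map_add, map_smul, smul_eq_mul]
  -- The interior point `(0, N + 1)` lies above `(0, μ)`, so the hyperplane is not vertical.
  have hc0 : c < 0 := by
    have h1 := hf _ hint
    rw [hfc, hfc 0 μ] at h1
    nlinarith
  obtain ⟨l, hl, -⟩ := exists_extension_norm_eq V
    (-(c⁻¹ • f.comp (ContinuousLinearMap.inl ℝ V ℝ)))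
  refine ⟨l, fun x p s hs => le_of_forall_gt_imp_ge_of_dense fun r hr => ?_⟩
  have hp : p ∈ V := hCV ⟨x, fun h => EReal.coe_ne_top s (top_le_iff.1 (h ▸ hs))⟩
  have h1 := hfE (⟨p, hp⟩, r) ⟨x, s, hr, hs⟩
  have h00 : f ((0 : V), (0 : ℝ)) = 0 := map_zero f
  rw [hfc, hfc 0 μ, h00] at h1
  have h2 : l p = -(c⁻¹ * f (⟨p, hp⟩, 0)) := hl ⟨p, hp⟩
  have h3 : c⁻¹ * c = 1 := inv_mul_cancel₀ hc0.ne
  have h4 := mul_le_mul_of_nonpos_left h1 (inv_lt_zero.2 hc0).le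
  rw [zero_add, mul_add, mul_left_comm, mul_left_comm _ r, h3] at h4
  linarith

end

/-! ### Karush–Kuhn–Tucker points -/

section

variable {X Y : Type*} [NormedAddCommGroup X] [InnerProductSpace ℝ X] [CompleteSpace X]
  [NormedAddCommGroup Y] [InnerProductSpace ℝ Y] [CompleteSpace Y]
  {K : X →L[ℝ] Y} {F : Y → EReal} {G H : X → EReal}

/-- The Karush–Kuhn–Tucker conditions of the problem `min_x F (K x) + G x + H x`. -/
structure IsKKT (K : X →L[ℝ] Y) (F : Y → EReal) (G H : X → EReal) (x y : X) (v : Y) : Prop where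
  sub_H : IsSubgradient H x (-y - K.adjoint v)
  sub_G : IsSubgradient G x y
  sub_F : IsSubgradient F (K x) v

/-- The linear terms cancel when the three subgradient inequalities are added. -/
theorem IsKKT.isSolution (hF : GammaZero F) (hG : GammaZero G) (hH : GammaZero H) {x y : X} {v : Y}
    (h : IsKKT K F G H x y v) : IsSolution K F G H x := by
  obtain ⟨⟨a, ha, h1⟩, ⟨b, hb, h2⟩, ⟨c, hc, h3⟩⟩ := h
  intro u
  rw [ha, hb, hc, ← EReal.coe_add, ← EReal.coe_add]
  rw [← EReal.le_of_forall_lt_iff_le]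
  intro t ht
  have hFG : F (K u) + G u ≠ ⊥ := by
    rw [Ne, EReal.add_eq_bot_iff]
    exact not_or.2 ⟨hF.ne_bot _, hG.ne_bot _⟩
  obtain ⟨r, s, h4, h5, h6⟩ := add_le_coe hFG (hH.ne_bot u) ht.le
  obtain ⟨r₁, r₂, h7, h8, h9⟩ := add_le_coe (hF.ne_bot _) (hG.ne_bot u) h4.le
  have e1 := h1 u s h5.le
  have e2 := h2 u r₂ h8.le
  have e3 := h3 (K u) r₁ h7.le
  rw [inner_sub_left, inner_neg_left, ContinuousLinearMap.adjoint_inner_left, map_sub] at e1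
  rw [EReal.coe_le_coe_iff]
  linarith

/-- Perturbing the arguments of `G` and `F` independently gives a function `Φ` whose feasible
perturbations are exactly the set in the qualification condition. The Riesz vectors of its
multiplier are `y` and `v`. -/
theorem exists_isKKT (hF : GammaZero F) (hG : GammaZero G) (hH : GammaZero H)
    (hqual : Qualification K F G H) {x : X} (hx : IsSolution K F G H x) :
    ∃ (y : X) (v : Y), IsKKT K F G H x y v := by
  let Φ : X × (X × Y) → EReal := fun q => H q.1 + (G (q.1 + q.2.1) + F (K q.1 + q.2.2))
  have hΦ : IsClosedConvex Φ :=
    (hH.isClosedConvex.comp_clm (ContinuousLinearMap.fst ℝ X (X × Y))).add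
      ((hG.isClosedConvex.comp_clm (ContinuousLinearMap.fst ℝ X (X × Y) +
        (ContinuousLinearMap.fst ℝ X Y).comp (ContinuousLinearMap.snd ℝ X (X × Y)))).add
      (hF.isClosedConvex.comp_clm (K.comp (ContinuousLinearMap.fst ℝ X (X × Y)) +
        (ContinuousLinearMap.snd ℝ X Y).comp (ContinuousLinearMap.snd ℝ X (X × Y)))))
  have hΦle : ∀ q (t : ℝ), Φ q ≤ t → ∃ a b c : ℝ, H q.1 = a ∧ G (q.1 + q.2.1) = b ∧
      F (K q.1 + q.2.2) = c ∧ a + b + c ≤ t := by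
    intro q t ht
    have hFG : G (q.1 + q.2.1) + F (K q.1 + q.2.2) ≠ ⊥ := by
      rw [Ne, EReal.add_eq_bot_iff]
      exact not_or.2 ⟨hG.ne_bot _, hF.ne_bot _⟩
    obtain ⟨r, s, h4, h5, h6⟩ := add_le_coe (hH.ne_bot _) hFG ht
    obtain ⟨r₁, r₂, h7, h8, h9⟩ := add_le_coe (hG.ne_bot _) (hF.ne_bot _) h5.le
    exact ⟨r, r₁, r₂, h4, h7, h8, by linarith⟩
  have hset : {p : X × Y | ∃ y ∈ dom G, ∃ v ∈ dom F, ∃ x ∈ dom H, p = (y - x, v - K x)} =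
      {p | ∃ x, Φ (x, p) ≠ ⊤} := by
    ext p
    constructor
    · rintro ⟨y, hy, v, hv, u, hu, rfl⟩
      refine ⟨u, ?_⟩
      change H u + (G (u + (y - u)) + F (K u + (v - K u))) ≠ ⊤
      rw [add_sub_cancel, add_sub_cancel]
      exact EReal.add_ne_top hu (EReal.add_ne_top hy hv)
    · rintro ⟨u, hu⟩
      obtain ⟨a, b, c, h1, h2, h3, -⟩ := hΦle (u, p) _ (EReal.coe_toReal hu (hΦ.ne_bot _)).ge
      refine ⟨u + p.1, ?_, K u + p.2, ?_, u, ?_, by simp⟩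
      · exact h2.trans_ne (EReal.coe_ne_top b)
      · exact h3.trans_ne (EReal.coe_ne_top c)
      · exact h1.trans_ne (EReal.coe_ne_top a)
  rw [Qualification, hset] at hqual
  have hΦ0 : ∀ u, Φ (u, 0) = F (K u) + G u + H u := fun u => by
    change H u + (G (u + 0) + F (K u + 0)) = _
    rw [add_zero, add_zero, add_comm (G u), add_comm]
  obtain ⟨u₀, hu₀⟩ := hqual.1
  have hfin : Φ (x, 0) ≠ ⊤ := by
    intro h
    have h1 := hx u₀
    rw [← hΦ0, ← hΦ0, h] at h1
    exact hu₀ (top_le_iff.1 h1)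
  obtain ⟨a, b, c, ha, hb, hc, -⟩ := hΦle (x, 0) _ (EReal.coe_toReal hfin (hΦ.ne_bot _)).ge
  simp only [Prod.fst_zero, Prod.snd_zero, add_zero] at ha hb hc
  have hval : Φ (x, 0) = ((c + b + a : ℝ) : EReal) := by
    rw [hΦ0, ha, hb, hc, EReal.coe_add, EReal.coe_add]
  obtain ⟨l, hl⟩ := hΦ.exists_multiplier (μ := c + b + a) (fun u s hs => by
    rw [← EReal.coe_le_coe_iff, ← hval, hΦ0]
    exact (hx u).trans ((hΦ0 u).symm.trans_le hs)) hqual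
  obtain ⟨y, hy⟩ : ∃ y : X, ∀ z, l (z, 0) = ⟪y, z⟫_ℝ :=
    ⟨(InnerProductSpace.toDual ℝ X).symm (l.comp (ContinuousLinearMap.inl ℝ X Y)), fun z => by
      rw [InnerProductSpace.toDual_symm_apply]; rfl⟩
  obtain ⟨v, hv⟩ : ∃ v : Y, ∀ z, l (0, z) = ⟪v, z⟫_ℝ :=
    ⟨(InnerProductSpace.toDual ℝ Y).symm (l.comp (ContinuousLinearMap.inr ℝ X Y)), fun z => by
      rw [InnerProductSpace.toDual_symm_apply]; rfl⟩
  have key : ∀ (u y' : X) (v' : Y) (r s t : ℝ), H u ≤ r → G y' ≤ s → F v' ≤ t →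
      c + b + a + (⟪y, y' - u⟫_ℝ + ⟪v, v' - K u⟫_ℝ) ≤ r + (s + t) := by
    intro u y' v' r s t hr hs ht
    have h1 : Φ (u, (y' - u, v' - K u)) ≤ ((r + (s + t) : ℝ) : EReal) := by
      change H u + (G (u + (y' - u)) + F (K u + (v' - K u))) ≤ _
      rw [add_sub_cancel, add_sub_cancel, EReal.coe_add, EReal.coe_add]
      exact add_le_add hr (add_le_add hs ht)
    have h2 := hl _ _ _ h1
    have h3 : (y' - u, v' - K u) = (y' - u, (0 : Y)) + ((0 : X), v' - K u) := by simp
    rwa [h3, map_add, hy, hv] at h2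
  -- In `key` the arguments of `H`, `G` and `F` are free; moving one and fixing the others at `x`,
  -- `x`, `K x` isolates one subgradient.
  refine ⟨y, v, ⟨a, ha, fun z s hs => ?_⟩, ⟨b, hb, fun z s hs => ?_⟩, ⟨c, hc, fun z s hs => ?_⟩⟩
  · have := key z x (K x) s b c hs hb.le hc.le
    rw [inner_sub_left, inner_neg_left, ContinuousLinearMap.adjoint_inner_left, map_sub]
    simp only [inner_sub_right] at this ⊢
    linarith
  · have := key x z (K x) a s c ha.le hs hc.le
    rw [sub_self, inner_zero_right] at this
    linarith
  · have := key x x z a b s ha.le hb.le hs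
    rw [sub_self, inner_zero_right] at this
    linarith

end

/-! ### Real sequences -/

theorem tendsto_zero_of_le_mul_add {b ε : ℕ → ℝ} {q : ℝ} (hq0 : 0 ≤ q) (hq1 : q < 1)
    (hb : ∀ k, 0 ≤ b k) (hbε : ∀ k, b (k + 1) ≤ q * b k + ε k) (hε : Tendsto ε atTop (𝓝 0)) :
    Tendsto b atTop (𝓝 0) := by
  rw [Metric.tendsto_atTop]
  intro η hη
  -- This threshold makes `η / 2` the fixed point of `t ↦ q * t + η / 2 * (1 - q)`.
  have hη' : 0 < η / 2 * (1 - q) := mul_pos (half_pos hη) (by linarith)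
  obtain ⟨N, hN⟩ := eventually_atTop.1 (hε.eventually_lt_const hη')
  have h1 : ∀ j, b (N + j) ≤ q ^ j * b N + η / 2 := by
    intro j
    induction j with
    | zero => simpa using (half_pos hη).le
    | succ j ih =>
      have h2 := hbε (N + j)
      have h3 := hN (N + j) (Nat.le_add_right _ _)
      have h4 := mul_le_mul_of_nonneg_left ih hq0
      rw [← add_assoc, pow_succ]
      nlinarith
  have h2 : Tendsto (fun j => q ^ j * b N) atTop (𝓝 (0 * b N)) :=
    (tendsto_pow_atTop_nhds_zero_of_lt_one hq0 hq1).mul_const _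
  rw [zero_mul] at h2
  obtain ⟨M, hM⟩ := eventually_atTop.1 (h2.eventually_lt_const (half_pos hη))
  refine ⟨N + M, fun n hn => ?_⟩
  obtain ⟨j, rfl⟩ := Nat.exists_eq_add_of_le ((Nat.le_add_right N M).trans hn)
  rw [Real.dist_eq, sub_zero, abs_of_nonneg (hb _)]
  linarith [h1 j, hM j (by omega)]

/-- The Lyapunov argument for inertial iterations: `φ k` is the squared distance to a fixed point
and `e k` is the square of the length of the `k`-th step. -/
theorem tendsto_of_inertial_le {φ e a c γ : ℕ → ℝ} {A θ Γ : ℝ} (hφ : ∀ k, 0 ≤ φ k)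
    (he : ∀ k, 0 ≤ e k) (ha0 : a 0 = 0) (ha : Monotone a) (haA : ∀ k, a k ≤ A) (hA : A < 1)
    (hγ0 : γ 0 = 0) (hγ : ∀ k, 0 ≤ γ k) (hγΓ : ∀ k, γ k ≤ Γ) (hθ : 0 < θ)
    (hc : ∀ k, γ (k + 1) + θ ≤ c k)
    (hstep : ∀ k, φ (k + 2) - (1 + a k) * φ (k + 1) + a k * φ k ≤ -c k * e (k + 1) + γ k * e k) :
    (∃ L, Tendsto φ atTop (𝓝 L)) ∧ Tendsto e atTop (𝓝 0) := by
  have ha_nonneg : ∀ k, 0 ≤ a k := fun k => ha0 ▸ ha (Nat.zero_le k)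
  have hA0 : 0 ≤ A := (ha_nonneg 0).trans (haA 0)
  -- The Lyapunov sequence: monotonicity of `a` and the gap `θ` in `hc` make it drop by at least `θ
  -- * e (k + 1)` at each step.
  set μ : ℕ → ℝ := fun k => φ (k + 1) - a k * φ k + γ k * e k with hμ
  have hμstep : ∀ k, μ (k + 1) ≤ μ k - θ * e (k + 1) := by
    intro k
    have h1 := mul_le_mul_of_nonneg_right (ha (Nat.le_succ k)) (hφ (k + 1))
    have h2 := mul_le_mul_of_nonneg_right (hc k) (he (k + 1))
    have h3 := hstep k
    simp only [hμ, Nat.succ_eq_add_one] at *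
    rw [show k + 1 + 1 = k + 2 from rfl]
    linarith
  have hμanti : Antitone μ := antitone_nat_of_succ_le fun k =>
    (hμstep k).trans (sub_le_self _ (mul_nonneg hθ.le (he _)))
  have hμ0 : μ 0 = φ 1 := by simp [hμ, ha0, hγ0]
  have hφstep : ∀ k, φ (k + 1) ≤ A * φ k + φ 1 := by
    intro k
    have h1 := hμanti (Nat.zero_le k)
    rw [hμ0] at h1
    have h2 := mul_le_mul_of_nonneg_right (haA k) (hφ k)
    have h3 := mul_nonneg (hγ k) (he k)
    simp only [hμ] at h1
    linarith
  have h1A : 0 < 1 - A := by linarith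
  set B := φ 0 + φ 1 / (1 - A) with hB
  have hφB : ∀ k, φ k ≤ B := by
    have h2 : 0 ≤ φ 1 / (1 - A) := div_nonneg (hφ 1) h1A.le
    have h3 : A * (φ 1 / (1 - A)) + φ 1 = φ 1 / (1 - A) := by field_simp; ring
    intro k
    induction k with
    | zero => linarith
    | succ k ih =>
      have h1 := mul_le_mul_of_nonneg_left ih hA0
      have h4 := mul_le_mul_of_nonneg_right hA.le (hφ 0)
      have h5 := hφstep k
      rw [hB, mul_add] at h1
      linarith
  have hB0 : 0 ≤ B := (hφ 0).trans (hφB 0)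
  have hμbdd : BddBelow (Set.range μ) := by
    refine ⟨-(A * B), ?_⟩
    rintro _ ⟨k, rfl⟩
    have h1 := mul_le_mul (haA k) (hφB k) (hφ k) hA0
    have h3 := mul_nonneg (hγ k) (he k)
    have h4 := hφ (k + 1)
    simp only [hμ]
    linarith
  have hμlim := tendsto_atTop_ciInf hμanti hμbdd
  set m := ⨅ k, μ k
  have he0 : Tendsto e atTop (𝓝 0) := by
    rw [← tendsto_add_atTop_iff_nat 1]
    have h1 : Tendsto (fun k => (μ k - μ (k + 1)) / θ) atTop (𝓝 ((m - m) / θ)) :=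
      (hμlim.sub ((tendsto_add_atTop_iff_nat 1).2 hμlim)).div_const θ
    rw [sub_self, zero_div] at h1
    refine squeeze_zero (fun k => he _) (fun k => ?_) h1
    rw [le_div_iff₀ hθ]
    linarith [hμstep k]
  refine ⟨?_, he0⟩
  have halim := tendsto_atTop_ciSup ha ⟨A, by rintro _ ⟨k, rfl⟩; exact haA k⟩
  set a' := ⨆ k, a k
  have ha'0 : 0 ≤ a' := ge_of_tendsto' halim ha_nonneg
  have ha'1 : a' < 1 := (le_of_tendsto' halim haA).trans_lt hA
  have hγe : Tendsto (fun k => γ k * e k) atTop (𝓝 0) :=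
    squeeze_zero (fun k => mul_nonneg (hγ k) (he k))
      (fun k => mul_le_mul_of_nonneg_right (hγΓ k) (he k)) (by simpa using he0.const_mul Γ)
  have haφ : Tendsto (fun k => (a' - a k) * φ k) atTop (𝓝 0) := by
    have h1 : Tendsto (fun k => (a' - a k) * B) atTop (𝓝 ((a' - a') * B)) :=
      (halim.const_sub a').mul_const B
    rw [sub_self, zero_mul] at h1
    have h2 : ∀ k, 0 ≤ a' - a k := fun k => sub_nonneg.2 (ha.ge_of_tendsto halim k)
    exact squeeze_zero (fun k => mul_nonneg (h2 k) (hφ k))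
      (fun k => mul_le_mul_of_nonneg_left (hφB k) (h2 k)) h1
  -- Since `γ k * e k` and `(a' - a k) * φ k` vanish in the limit, `φ (k + 1) - a' * φ k` tends to
  -- `m`. As `a' < 1`, this recursion contracts towards its fixed point `L`.
  set L := m / (1 - a') with hL
  have hLm : L - a' * L = m := by
    have : (1 - a') ≠ 0 := by linarith
    rw [hL]
    field_simp
  have hε : Tendsto (fun k => |μ k - γ k * e k - (a' - a k) * φ k - m|) atTop (𝓝 0) := by
    have h1 := (((hμlim.sub hγe).sub haφ).sub_const m).abs
    simpa using h1
  refine ⟨L, ?_⟩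
  rw [tendsto_iff_dist_tendsto_zero]
  simp only [Real.dist_eq]
  refine tendsto_zero_of_le_mul_add ha'0 ha'1 (fun k => abs_nonneg _) (fun k => ?_) hε
  have h1 : φ (k + 1) - L = a' * (φ k - L) + (μ k - γ k * e k - (a' - a k) * φ k - m) := by
    simp only [hμ]
    rw [← hLm]
    ring
  rw [h1]
  refine (abs_add_le _ _).trans ?_
  rw [abs_mul, abs_of_nonneg ha'0]

/-! ### The inertial Krasnosel'skii–Mann iteration -/

section

variable {E : Type*} [NormedAddCommGroup E] [InnerProductSpace ℝ E] {T : E → E}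

/-- Demiclosedness of `Id - T` at `0` for a nonexpansive map `T`. -/
theorem eq_of_weak_limit_of_nonexpansive (hT : ∀ x y, ‖T x - T y‖ ≤ ‖x - y‖) {ι : Type*}
    {l : Filter ι} [l.NeBot] {w : ι → E} {u : E} {B : ℝ} (hB : ∀ i, ‖w i‖ ≤ B)
    (hw : ∀ z, Tendsto (fun i => ⟪w i, z⟫_ℝ) l (𝓝 ⟪u, z⟫_ℝ))
    (hTw : Tendsto (fun i => ‖T (w i) - w i‖) l (𝓝 0)) : T u = u := by
  -- Expand `‖w i - T u‖ ^ 2` around `u` and bound it through `‖w i - T u‖ ≤ ‖T (w i) - w i‖ + ‖w i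
  -- - u‖`; what remains on the right tends to zero.
  have h1 : ∀ i, ‖u - T u‖ ^ 2 ≤ ‖T (w i) - w i‖ * ‖T (w i) - w i‖ +
      2 * (‖T (w i) - w i‖ * (B + ‖u‖)) - 2 * (⟪w i, u - T u⟫_ℝ - ⟪u, u - T u⟫_ℝ) := by
    intro i
    have h2 : ‖w i - T u‖ ≤ ‖T (w i) - w i‖ + ‖w i - u‖ := by
      have : w i - T u = -(T (w i) - w i) + (T (w i) - T u) := by abel
      rw [this]
      refine (norm_add_le _ _).trans ?_
      rw [norm_neg]
      exact add_le_add le_rfl (hT _ _)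
    have h3 : ‖w i - T u‖ ^ 2 = ‖w i - u‖ ^ 2 + 2 * ⟪w i - u, u - T u⟫_ℝ + ‖u - T u‖ ^ 2 := by
      rw [← norm_add_sq_real, sub_add_sub_cancel]
    have h4 : ‖w i - u‖ ≤ B + ‖u‖ := (norm_sub_le _ _).trans (add_le_add (hB i) le_rfl)
    have h5 := pow_le_pow_left₀ (norm_nonneg _) h2 2
    have h6 := mul_le_mul_of_nonneg_left h4 (norm_nonneg (T (w i) - w i))
    rw [inner_sub_left] at h3
    nlinarith
  have h2 : Tendsto (fun i => ‖T (w i) - w i‖ * ‖T (w i) - w i‖ +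
      2 * (‖T (w i) - w i‖ * (B + ‖u‖)) - 2 * (⟪w i, u - T u⟫_ℝ - ⟪u, u - T u⟫_ℝ)) l
      (𝓝 (0 * 0 + 2 * (0 * (B + ‖u‖)) - 2 * (⟪u, u - T u⟫_ℝ - ⟪u, u - T u⟫_ℝ))) :=
    ((hTw.mul hTw).add ((hTw.mul_const _).const_mul 2)).sub
      (((hw _).sub_const _).const_mul 2)
  have h3 := ge_of_tendsto' h2 h1
  have h4 : ‖u - T u‖ ^ 2 = 0 := le_antisymm (by simpa using h3) (sq_nonneg _)
  exact (sub_eq_zero.1 (norm_eq_zero.1 (pow_eq_zero_iff two_ne_zero |>.1 h4))).symm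

/-- Opial's lemma. -/
theorem exists_weak_limit_of_opial [CompleteSpace E] {x : ℕ → E} {S : Set E} (hS : S.Nonempty)
    (hconv : ∀ u ∈ S, ∃ L, Tendsto (fun k => ‖x k - u‖ ^ 2) atTop (𝓝 L))
    (hlim : ∀ (𝒰 : Ultrafilter ℕ) (u : E), (𝒰 : Filter ℕ) ≤ atTop →
      (∀ z, Tendsto (fun k => ⟪x k, z⟫_ℝ) 𝒰 (𝓝 ⟪u, z⟫_ℝ)) → u ∈ S) :
    ∃ u ∈ S, WeaklyConvergesTo x u := by
  obtain ⟨u₀, hu₀⟩ := hS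
  obtain ⟨L, hL⟩ := hconv u₀ hu₀
  have hbdd : ∀ᶠ k in atTop, ‖x k‖ ≤ √(L + 1) + ‖u₀‖ := by
    filter_upwards [hL.eventually_lt_const (lt_add_one L)] with k hk
    have h1 : ‖x k - u₀‖ ≤ √(L + 1) := Real.le_sqrt_of_sq_le hk.le
    have h2 : ‖x k‖ ≤ ‖x k - u₀‖ + ‖u₀‖ := by simpa using norm_add_le (x k - u₀) u₀
    linarith
  have hex : ∀ 𝒰 : Ultrafilter ℕ, (𝒰 : Filter ℕ) ≤ atTop →
      ∃ u ∈ S, ∀ z, Tendsto (fun k => ⟪x k, z⟫_ℝ) 𝒰 (𝓝 ⟪u, z⟫_ℝ) := by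
    intro 𝒰 h𝒰
    obtain ⟨u, hu⟩ := exists_weak_limit 𝒰 (hbdd.filter_mono h𝒰)
    exact ⟨u, hlim 𝒰 u h𝒰 hu, hu⟩
  obtain ⟨u, hu, hux⟩ := hex (hyperfilter ℕ) Nat.hyperfilter_le_atTop
  refine ⟨u, hu, fun w => ?_⟩
  rw [tendsto_iff_ultrafilter]
  intro 𝒰 h𝒰
  obtain ⟨v, hv, hvx⟩ := hex 𝒰 h𝒰
  suffices huv : u = v from huv ▸ hvx w
  obtain ⟨L₁, hL₁⟩ := hconv u hu
  obtain ⟨L₂, hL₂⟩ := hconv v hv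
  -- The left side converges along the whole sequence and the right side is affine in `x k`, so the
  -- weak limits `u` and `v` have the same inner product with `u - v`.
  have h1 : ∀ k, ‖x k - u‖ ^ 2 - ‖x k - v‖ ^ 2 = ‖u‖ ^ 2 - ‖v‖ ^ 2 - 2 * ⟪x k, u - v⟫_ℝ := by
    intro k
    rw [norm_sub_sq_real, norm_sub_sq_real, inner_sub_right]
    ring
  have h2 : ∀ (𝒱 : Ultrafilter ℕ) (a : E), (𝒱 : Filter ℕ) ≤ atTop →
      (∀ z, Tendsto (fun k => ⟪x k, z⟫_ℝ) 𝒱 (𝓝 ⟪a, z⟫_ℝ)) →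
      ‖u‖ ^ 2 - ‖v‖ ^ 2 - 2 * ⟪a, u - v⟫_ℝ = L₁ - L₂ := by
    intro 𝒱 a h𝒱 ha
    refine tendsto_nhds_unique (((ha (u - v)).const_mul 2).const_sub _) ?_
    simp only [← h1]
    exact (hL₁.sub hL₂).mono_left h𝒱
  have h3 := h2 _ u Nat.hyperfilter_le_atTop hux
  have h4 := h2 _ v h𝒰 hvx
  have h5 : ⟪u - v, u - v⟫_ℝ = 0 := by
    rw [inner_sub_left]
    linarith
  exact sub_eq_zero.1 (inner_self_eq_zero.1 h5)

/-- One step of the inertial iteration: `p = x k - u`, `D = x k - x (k - 1)` and `r` is the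
residual at the extrapolated point. -/
theorem inertial_step_le {p D r : E} {a s δ : ℝ} (ha : 0 ≤ a) (hs : 0 < s) (hs1 : s ≤ 1)
    (hδ : 0 < δ) (h : ‖p + a • D + r‖ ≤ ‖p + a • D‖) :
    ‖p + (a • D + s • r)‖ ^ 2 - (1 + a) * ‖p‖ ^ 2 + a * ‖p - D‖ ^ 2 ≤
      -((1 - s) * δ / (a + δ * s)) * ‖a • D + s • r‖ ^ 2 +
        (a * (1 + a) + a * (1 - s) * δ) * ‖D‖ ^ 2 := by
  have hpos : 0 < a + δ * s := by positivity
  have h1 := pow_le_pow_left₀ (norm_nonneg _) h 2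
  rw [norm_add_sq_real] at h1
  have h2 : ‖p + (a • D + s • r)‖ ^ 2 = ‖p + a • D‖ ^ 2 + s * (2 * ⟪p + a • D, r⟫_ℝ) +
      s ^ 2 * ‖r‖ ^ 2 := by
    rw [← add_assoc, norm_add_sq_real (p + a • D), real_inner_smul_right, norm_smul, mul_pow,
      Real.norm_eq_abs, sq_abs]
    ring
  have h3 : ‖p + a • D‖ ^ 2 = ‖p‖ ^ 2 + 2 * (a * ⟪p, D⟫_ℝ) + a ^ 2 * ‖D‖ ^ 2 := by
    rw [norm_add_sq_real, real_inner_smul_right, norm_smul, mul_pow, Real.norm_eq_abs, sq_abs]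
  have h4 : ‖p - D‖ ^ 2 = ‖p‖ ^ 2 - 2 * ⟪p, D⟫_ℝ + ‖D‖ ^ 2 := norm_sub_sq_real _ _
  have h5 : ‖a • D + s • r‖ ^ 2 = a ^ 2 * ‖D‖ ^ 2 + 2 * (a * s * ⟪D, r⟫_ℝ) + s ^ 2 * ‖r‖ ^ 2 := by
    rw [norm_add_sq_real, real_inner_smul_right, real_inner_smul_left, norm_smul, norm_smul,
      mul_pow, mul_pow, Real.norm_eq_abs, Real.norm_eq_abs, sq_abs, sq_abs]
    ring
  -- After clearing the denominator the two sides differ by exactly `a * s * ‖r - δ • D‖ ^ 2`. This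
  -- trades the decrease `s * (1 - s) * ‖r‖ ^ 2` coming from nonexpansiveness for one in the new
  -- step length.
  have h6 : δ / (a + δ * s) * ‖a • D + s • r‖ ^ 2 ≤ s * ‖r‖ ^ 2 + a * δ * ‖D‖ ^ 2 := by
    rw [div_mul_eq_mul_div, div_le_iff₀ hpos, h5]
    have h7 : ‖r - δ • D‖ ^ 2 = ‖r‖ ^ 2 - 2 * (δ * ⟪D, r⟫_ℝ) + δ ^ 2 * ‖D‖ ^ 2 := by
      rw [norm_sub_sq_real, real_inner_smul_right, norm_smul, mul_pow, Real.norm_eq_abs, sq_abs,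
        real_inner_comm]
    have h8 := mul_nonneg (mul_nonneg ha hs.le) (sq_nonneg ‖r - δ • D‖)
    rw [h7] at h8
    linarith
  have h8 := mul_le_mul_of_nonneg_left h6 (sub_nonneg.2 hs1)
  have h9 : (1 - s) * δ / (a + δ * s) * ‖a • D + s • r‖ ^ 2 =
      (1 - s) * (δ / (a + δ * s) * ‖a • D + s • r‖ ^ 2) := by ring
  have h10 := mul_le_mul_of_nonneg_left h1 hs.le
  rw [h2, neg_mul, h9, h4]
  nlinarith

/-- Weak convergence of the inertial Krasnosel'skii–Mann iteration. -/
theorem exists_weak_limit_inertial [CompleteSpace E] (hT : ∀ x y, ‖T x - T y‖ ≤ ‖x - y‖)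
    (hfix : ∃ u, T u = u) {a ρ : ℕ → ℝ} {A ρmin θ δ : ℝ} (ha0 : a 0 = 0) (ha : Monotone a)
    (haA : ∀ k, a k ≤ A) (hA : A < 1) (hρmin : 0 < ρmin) (hθ : 0 < θ) (hδ : 0 < δ)
    (hρ : ∀ k, ρmin ≤ ρ k)
    (hρ' : ∀ k, ρ k < (δ - A * (A * (1 + A) + A * δ + θ)) / (δ * (1 + A * (1 + A) + A * δ + θ)))
    {x : ℕ → E} (hx : ∀ k, x (k + 2) = ρ k • T (x (k + 1) + a k • (x (k + 1) - x k)) +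
      (1 - ρ k) • (x (k + 1) + a k • (x (k + 1) - x k))) :
    ∃ u, T u = u ∧ WeaklyConvergesTo x u := by
  have ha_nonneg : ∀ k, 0 ≤ a k := fun k => ha0 ▸ ha (Nat.zero_le k)
  have hA0 : 0 ≤ A := (ha_nonneg 0).trans (haA 0)
  have hρpos : ∀ k, 0 < ρ k := fun k => hρmin.trans_le (hρ k)
  set Γ := A * (1 + A) + A * δ with hΓ
  have hΓ0 : 0 ≤ Γ := by positivity
  -- The upper bound on `ρ k`, cleared of its denominator: it says that the decrease coefficient
  -- dominates the next growth coefficient plus `θ`.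
  have hρΓ : ∀ k, (Γ + θ) * (A + δ * ρ k) ≤ (1 - ρ k) * δ := by
    intro k
    have h1 := hρ' k
    rw [lt_div_iff₀ (by positivity)] at h1
    rw [hΓ]
    nlinarith
  have hρ1 : ∀ k, ρ k ≤ 1 := by
    intro k
    have h1 : 0 ≤ (Γ + θ) * (A + δ * ρ k) := by
      have := hρpos k
      positivity
    have h2 : 0 ≤ (1 - ρ k) * δ := h1.trans (hρΓ k)
    linarith [nonneg_of_mul_nonneg_left h2 hδ]
  set w : ℕ → E := fun k => x (k + 1) + a k • (x (k + 1) - x k) with hw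
  have hxw : ∀ k, x (k + 2) - x (k + 1) = a k • (x (k + 1) - x k) + ρ k • (T (w k) - w k) := by
    intro k
    rw [hx k]
    change ρ k • T (w k) + (1 - ρ k) • w k - x (k + 1) = _
    have : a k • (x (k + 1) - x k) = w k - x (k + 1) := (add_sub_cancel_left _ _).symm
    rw [this]
    module
  have hlyap : ∀ u, T u = u → (∃ L, Tendsto (fun k => ‖x k - u‖ ^ 2) atTop (𝓝 L)) ∧
      Tendsto (fun k => ‖x (k + 1) - x k‖ ^ 2) atTop (𝓝 0) := by
    intro u hu
    have hγA : ∀ k, a k * (1 + a k) + a k * (1 - ρ k) * δ ≤ Γ := by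
      intro k
      have h1 := mul_le_mul (haA k) (add_le_add_right (haA k) 1)
        (by linarith [ha_nonneg k]) hA0
      have h2 : a k * (1 - ρ k) ≤ A * 1 := mul_le_mul (haA k) (by linarith [hρpos k])
        (sub_nonneg.2 (hρ1 k)) hA0
      have h3 := mul_le_mul_of_nonneg_right h2 hδ.le
      rw [mul_one] at h3
      linarith
    refine tendsto_of_inertial_le (a := a) (A := A) (θ := θ) (Γ := Γ)
      (c := fun k => (1 - ρ k) * δ / (a k + δ * ρ k))
      (γ := fun k => a k * (1 + a k) + a k * (1 - ρ k) * δ)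
      (fun k => sq_nonneg _) (fun k => sq_nonneg _) ha0 ha haA hA (by simp [ha0]) (fun k => ?_)
      hγA hθ (fun k => ?_) (fun k => ?_)
    · have h1 := ha_nonneg k
      have h2 := sub_nonneg.2 (hρ1 k)
      positivity
    · have h1 := ha_nonneg k
      have h2 := hρpos k
      rw [le_div_iff₀ (by positivity)]
      refine le_trans ?_ (hρΓ k)
      exact mul_le_mul (add_le_add_left (hγA (k + 1)) θ) (add_le_add_left (haA k) _)
        (by positivity) (by positivity)
    · have h1 := inertial_step_le (p := x (k + 1) - u) (D := x (k + 1) - x k)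
        (r := T (w k) - w k) (ha_nonneg k) (hρpos k) (hρ1 k) hδ (by
          have h2 : x (k + 1) - u + a k • (x (k + 1) - x k) = w k - u := by
            simp only [hw]
            abel
          rw [h2, show w k - u + (T (w k) - w k) = T (w k) - T u by rw [hu]; abel]
          exact hT _ _)
      rw [← hxw] at h1
      rwa [show x (k + 1) - u + (x (k + 2) - x (k + 1)) = x (k + 2) - u by abel,
        show x (k + 1) - u - (x (k + 1) - x k) = x k - u by abel] at h1
  obtain ⟨u₀, hu₀⟩ := hfix
  obtain ⟨⟨L, hL⟩, he⟩ := hlyap u₀ hu₀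
  have hD : Tendsto (fun k => ‖x (k + 1) - x k‖) atTop (𝓝 0) := by
    have h1 := he.sqrt
    simpa only [Real.sqrt_sq (norm_nonneg _), Real.sqrt_zero] using h1
  have haD : Tendsto (fun k => a k • (x (k + 1) - x k)) atTop (𝓝 0) := by
    refine squeeze_zero_norm (fun k => ?_) hD
    rw [norm_smul, Real.norm_of_nonneg (ha_nonneg k)]
    exact mul_le_of_le_one_left (norm_nonneg _) ((haA k).trans hA.le)
  -- The residual is `(ρ k)⁻¹` times a difference of vanishing terms, and `ρ k` stays above `ρmin`.
  have hr : Tendsto (fun k => ‖T (w k) - w k‖) atTop (𝓝 0) := by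
    have h1 : Tendsto (fun k => (‖x (k + 1 + 1) - x (k + 1)‖ + ‖a k • (x (k + 1) - x k)‖) / ρmin)
        atTop (𝓝 ((0 + ‖(0 : E)‖) / ρmin)) :=
      (((tendsto_add_atTop_iff_nat 1).2 hD).add haD.norm).div_const _
    rw [norm_zero, add_zero, zero_div] at h1
    refine squeeze_zero (fun k => norm_nonneg _) (fun k => ?_) h1
    rw [le_div_iff₀ hρmin]
    have h2 : ρ k • (T (w k) - w k) = (x (k + 2) - x (k + 1)) - a k • (x (k + 1) - x k) := by
      rw [hxw]
      abel
    have h3 := norm_sub_le (x (k + 2) - x (k + 1)) (a k • (x (k + 1) - x k))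
    rw [← h2, norm_smul, Real.norm_of_nonneg (hρpos k).le] at h3
    refine le_trans ?_ h3
    rw [mul_comm]
    exact mul_le_mul_of_nonneg_right (hρ k) (norm_nonneg _)
  obtain ⟨B, hB⟩ : ∃ B, ∀ k, ‖w k‖ ≤ B := by
    obtain ⟨B₁, hB₁⟩ := hL.bddAbove_range
    obtain ⟨B₂, hB₂⟩ := haD.norm.bddAbove_range
    refine ⟨√B₁ + ‖u₀‖ + B₂, fun k => ?_⟩
    have h1 : ‖x (k + 1) - u₀‖ ≤ √B₁ := Real.le_sqrt_of_sq_le (hB₁ ⟨k + 1, rfl⟩)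
    have h2 : ‖x (k + 1)‖ ≤ ‖x (k + 1) - u₀‖ + ‖u₀‖ := by
      simpa using norm_add_le (x (k + 1) - u₀) u₀
    have h3 : ‖a k • (x (k + 1) - x k)‖ ≤ B₂ := hB₂ ⟨k, rfl⟩
    have h4 := norm_add_le (x (k + 1)) (a k • (x (k + 1) - x k))
    simp only [hw]
    linarith
  -- The shifted sequence differs from `w k` by the vanishing inertial term, so both have the same
  -- weak limits along ultrafilters.
  obtain ⟨u, hu, hux⟩ := exists_weak_limit_of_opial (x := fun k => x (k + 1)) (S := {u | T u = u})
    ⟨u₀, hu₀⟩ (fun u hu => (hlyap u hu).1.imp fun L hL => (tendsto_add_atTop_iff_nat 1).2 hL)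
    fun 𝒰 u h𝒰 hu => by
      refine eq_of_weak_limit_of_nonexpansive hT (l := 𝒰) hB (fun z => ?_) (hr.mono_left h𝒰)
      have h1 : Tendsto (fun k => ⟪x (k + 1), z⟫_ℝ + ⟪a k • (x (k + 1) - x k), z⟫_ℝ) 𝒰
          (𝓝 (⟪u, z⟫_ℝ + ⟪(0 : E), z⟫_ℝ)) :=
        (hu z).add ((haD.mono_left h𝒰).inner tendsto_const_nhds)
      simpa only [hw, inner_add_left, inner_zero_left, add_zero] using h1
  exact ⟨u, hu, fun z => (tendsto_add_atTop_iff_nat 1).1 (hux z)⟩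

end

/-! ### Inertial iterations that are nonexpansive in a preconditioned norm -/

/-- Weak convergence of the inertial Krasnosel'skii–Mann iteration of a map that is nonexpansive
for the norm of a positive definite operator. -/
theorem PosDef.exists_weak_limit_inertial {E : Type*} [NormedAddCommGroup E]
    [InnerProductSpace ℝ E] [CompleteSpace E] {M : E →L[ℝ] E} (hM : PosDef M) {J : E → E}
    (hJ : ∀ x y, ⟪M (J x - J y), J x - J y⟫_ℝ ≤ ⟪M (x - y), x - y⟫_ℝ)
    (hfix : ∃ u, J u = u) {a ρ : ℕ → ℝ} {A ρmin θ δ : ℝ} (ha0 : a 0 = 0) (ha : Monotone a)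
    (haA : ∀ k, a k ≤ A) (hA : A < 1) (hρmin : 0 < ρmin) (hθ : 0 < θ) (hδ : 0 < δ)
    (hρ : ∀ k, ρmin ≤ ρ k)
    (hρ' : ∀ k, ρ k < (δ - A * (A * (1 + A) + A * δ + θ)) / (δ * (1 + A * (1 + A) + A * δ + θ)))
    {x : ℕ → E} (hx : ∀ k, x (k + 2) = ρ k • J (x (k + 1) + a k • (x (k + 1) - x k)) +
      (1 - ρ k) • (x (k + 1) + a k • (x (k + 1) - x k))) :
    ∃ u, J u = u ∧ WeaklyConvergesTo x u := by
  -- Since `‖R z‖ ^ 2 = ⟪M z, z⟫`, the conjugated map `R ∘ J ∘ R⁻¹` is nonexpansive in the original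
  -- norm, and `R x k` follows its inertial iteration.
  obtain ⟨R, hR, hRM⟩ := hM.exists_sqrt
  have hRu : IsUnit R := by
    have h1 : IsUnit (R * R) := by
      rw [ContinuousLinearMap.mul_def, hRM]
      exact hM.isUnit
    exact ((Commute.refl R).isUnit_mul_iff.1 h1).1
  set Q := Ring.inverse R with hQ
  have hQR : ∀ z, Q (R z) = z := fun z => by
    simpa using congrArg (fun B : E →L[ℝ] E => B z) (Ring.inverse_mul_cancel R hRu)
  have hRQ : ∀ z, R (Q z) = z := fun z => by
    simpa using congrArg (fun B : E →L[ℝ] E => B z) (Ring.mul_inverse_cancel R hRu)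
  have hnorm : ∀ z, ‖R z‖ ^ 2 = ⟪M z, z⟫_ℝ := fun z => by
    rw [← hRM, ← real_inner_self_eq_norm_sq, ContinuousLinearMap.comp_apply]
    exact (hR.isSelfAdjoint.isSymmetric (R z) z).symm
  obtain ⟨u, hu, hux⟩ := IPDFP.exists_weak_limit_inertial (T := fun z => R (J (Q z)))
    (x := fun k => R (x k)) (a := a) (ρ := ρ) (fun z w => by
      refine le_of_sq_le_sq ?_ (norm_nonneg _)
      have h1 := hJ (Q z) (Q w)
      rw [← map_sub, hnorm]
      refine h1.trans_eq ?_
      rw [← hnorm, map_sub, hRQ, hRQ]) (by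
      obtain ⟨u, hu⟩ := hfix
      exact ⟨R u, by rw [hQR, hu]⟩) ha0 ha haA hA hρmin hθ hδ hρ hρ' (fun k => by
      have h1 : R (x (k + 1)) + a k • (R (x (k + 1)) - R (x k)) =
          R (x (k + 1) + a k • (x (k + 1) - x k)) := by
        rw [map_add, map_smul, map_sub]
      rw [h1, hQR, ← map_smul, ← map_smul, ← map_add, ← hx])
  refine ⟨Q u, ?_, fun z => ?_⟩
  · have := congrArg Q hu
    rwa [hQR] at this
  · have := hux (Q.adjoint z)
    simpa only [ContinuousLinearMap.adjoint_inner_right, hQR] using this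

/-! ### The primal-dual inclusion -/

/-- The Hilbert sum `X ⊕ X ⊕ Y`. -/
abbrev PrimalDual (X Y : Type*) := WithLp 2 (X × WithLp 2 (X × Y))

theorem PrimalDual.ext {X Y : Type*} {z w : PrimalDual X Y} (h1 : z.fst = w.fst)
    (h2 : z.snd.fst = w.snd.fst) (h3 : z.snd.snd = w.snd.snd) : z = w :=
  WithLp.ofLp_injective 2 (Prod.ext h1 (WithLp.ofLp_injective 2 (Prod.ext h2 h3)))

theorem PrimalDual.norm_sq_eq {X Y : Type*} [NormedAddCommGroup X] [NormedAddCommGroup Y]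
    (z : PrimalDual X Y) : ‖z‖ ^ 2 = ‖z.fst‖ ^ 2 + (‖z.snd.fst‖ ^ 2 + ‖z.snd.snd‖ ^ 2) := by
  rw [WithLp.prod_norm_sq_eq_of_L2, WithLp.prod_norm_sq_eq_of_L2]

theorem PrimalDual.inner_eq {X Y : Type*} [NormedAddCommGroup X] [InnerProductSpace ℝ X]
    [NormedAddCommGroup Y] [InnerProductSpace ℝ Y] (z w : PrimalDual X Y) : ⟪z, w⟫_ℝ =
    ⟪z.fst, w.fst⟫_ℝ + (⟪z.snd.fst, w.snd.fst⟫_ℝ + ⟪z.snd.snd, w.snd.snd⟫_ℝ) := by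
  rw [WithLp.prod_inner_apply]
  congr 1

section

variable {X Y : Type*} [NormedAddCommGroup X] [InnerProductSpace ℝ X] [CompleteSpace X]
  [NormedAddCommGroup Y] [InnerProductSpace ℝ Y] [CompleteSpace Y]

variable (K : X →L[ℝ] Y) (F : Y → EReal) (G H : X → EReal) (S U : X →L[ℝ] X) (T : Y →L[ℝ] Y)

/-- The preconditioner `(x, y, v) ↦ (S⁻¹ x - y - K* v, U⁻¹ y - x, T⁻¹ v - K x)`. -/
noncomputable def preconditioner : PrimalDual X Y →L[ℝ] PrimalDual X Y where
  toFun z := WithLp.toLp 2 (Ring.inverse S z.fst - z.snd.fst - K.adjoint z.snd.snd,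
    WithLp.toLp 2 (Ring.inverse U z.snd.fst - z.fst, Ring.inverse T z.snd.snd - K z.fst))
  map_add' z w := by
    refine PrimalDual.ext ?_ ?_ ?_ <;> simp <;> abel
  map_smul' c z := by
    refine PrimalDual.ext ?_ ?_ ?_ <;> simp [smul_sub]
  cont := by fun_prop

@[simp] theorem preconditioner_fst (z : PrimalDual X Y) : (preconditioner K S U T z).fst =
    Ring.inverse S z.fst - z.snd.fst - K.adjoint z.snd.snd := rfl

@[simp] theorem preconditioner_snd_fst (z : PrimalDual X Y) :
    (preconditioner K S U T z).snd.fst = Ring.inverse U z.snd.fst - z.fst := rfl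

@[simp] theorem preconditioner_snd_snd (z : PrimalDual X Y) :
    (preconditioner K S U T z).snd.snd = Ring.inverse T z.snd.snd - K z.fst := rfl

variable {S U T}

/-- The vector is `S^{-1/2} x`, written as `S^{1/2} S⁻¹ x`. This change of variables brings the
operator norms of the step-size condition into the cross terms of the preconditioner. -/
theorem PosDef.exists_sqrt_eq {E : Type*} [NormedAddCommGroup E] [InnerProductSpace ℝ E]
    [CompleteSpace E] {S : E →L[ℝ] E} (hS : PosDef S) (x : E) :
    ∃ a, hS.sqrt a = x ∧ ‖a‖ ^ 2 = ⟪Ring.inverse S x, x⟫_ℝ := by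
  obtain ⟨h1, h2⟩ : hS.sqrt.IsPositive ∧ hS.sqrt ∘L hS.sqrt = S := hS.exists_sqrt.choose_spec
  have h3 : ∀ z, hS.sqrt (hS.sqrt z) = S z := fun z => congrArg (fun B : E →L[ℝ] E => B z) h2
  refine ⟨hS.sqrt (Ring.inverse S x), by rw [h3, hS.apply_inverse], ?_⟩
  have h4 : ⟪hS.sqrt (Ring.inverse S x), hS.sqrt (Ring.inverse S x)⟫_ℝ =
      ⟪Ring.inverse S x, hS.sqrt (hS.sqrt (Ring.inverse S x))⟫_ℝ :=
    h1.isSelfAdjoint.isSymmetric _ _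
  rw [← real_inner_self_eq_norm_sq, h4, h3, hS.apply_inverse]

theorem PosDef.inner_sqrt_comm {E : Type*} [NormedAddCommGroup E] [InnerProductSpace ℝ E]
    [CompleteSpace E] {S : E →L[ℝ] E} (hS : PosDef S) (x y : E) :
    ⟪hS.sqrt x, y⟫_ℝ = ⟪x, hS.sqrt y⟫_ℝ :=
  hS.exists_sqrt.choose_spec.1.isSelfAdjoint.isSymmetric x y

/-- The smallest eigenvalue of the form on the right is `1 - √(p ^ 2 + q ^ 2)`; the proof is a
sum-of-squares identity. -/
theorem add_sq_sub_ge {p q κ A B C : ℝ} (hκ : 0 < κ) (h : p ^ 2 + q ^ 2 ≤ κ ^ 2) :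
    (1 - κ) * (A ^ 2 + B ^ 2 + C ^ 2) ≤
      A ^ 2 + B ^ 2 + C ^ 2 - 2 * (p * A * B) - 2 * (q * A * C) := by
  have h1 : 0 ≤ κ * (κ * (A ^ 2 + B ^ 2 + C ^ 2) - 2 * (p * A * B) - 2 * (q * A * C)) := by
    have h2 : κ * (κ * (A ^ 2 + B ^ 2 + C ^ 2) - 2 * (p * A * B) - 2 * (q * A * C)) =
        (κ * A - p * B - q * C) ^ 2 + (q * B - p * C) ^ 2 +
          (κ ^ 2 - (p ^ 2 + q ^ 2)) * (B ^ 2 + C ^ 2) := by ring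
    rw [h2]
    have := sub_nonneg.2 h
    positivity
  linarith [nonneg_of_mul_nonneg_right h1 hκ]

theorem posDef_preconditioner (hS : PosDef S) (hU : PosDef U) (hT : PosDef T)
    (hnorm : ‖hS.sqrt ∘L hU.sqrt‖ ^ 2 + ‖hS.sqrt ∘L K.adjoint ∘L hT.sqrt‖ ^ 2 < 1) :
    PosDef (preconditioner K S U T) := by
  refine ⟨?_, ?_⟩
  · rw [ContinuousLinearMap.isSelfAdjoint_iff_isSymmetric]
    intro z w
    change ⟪preconditioner K S U T z, w⟫_ℝ = ⟪z, preconditioner K S U T w⟫_ℝ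
    rw [PrimalDual.inner_eq, PrimalDual.inner_eq]
    simp only [preconditioner_fst, preconditioner_snd_fst, preconditioner_snd_snd,
      inner_sub_left, inner_sub_right, hS.inverse.inner_map_comm, hU.inverse.inner_map_comm,
      hT.inverse.inner_map_comm, ContinuousLinearMap.adjoint_inner_left,
      ContinuousLinearMap.adjoint_inner_right]
    ring
  · set p := ‖hS.sqrt ∘L hU.sqrt‖
    set q := ‖hS.sqrt ∘L K.adjoint ∘L hT.sqrt‖
    -- Averaging with `1` gives `κ < 1` and `p ^ 2 + q ^ 2 ≤ κ ^ 2`, and keeps `κ` positive even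
    -- when `p = q = 0`.
    set κ := (1 + (p ^ 2 + q ^ 2)) / 2 with hκ
    have hpq : 0 ≤ p ^ 2 + q ^ 2 := by positivity
    have hκ0 : 0 < κ := by rw [hκ]; linarith
    have hκ1 : 0 < 1 - κ := by rw [hκ]; linarith
    have hκpq : p ^ 2 + q ^ 2 ≤ κ ^ 2 := by
      rw [hκ]
      nlinarith [sq_nonneg (1 - (p ^ 2 + q ^ 2))]
    obtain ⟨c₁, hc₁, h₁⟩ := hS.inverse.coercive
    obtain ⟨c₂, hc₂, h₂⟩ := hU.inverse.coercive
    obtain ⟨c₃, hc₃, h₃⟩ := hT.inverse.coercive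
    have hc : 0 < min c₁ (min c₂ c₃) := lt_min hc₁ (lt_min hc₂ hc₃)
    refine ⟨(1 - κ) * min c₁ (min c₂ c₃), mul_pos hκ1 hc, fun z => ?_⟩
    obtain ⟨a, ha, ha'⟩ := hS.exists_sqrt_eq z.fst
    obtain ⟨b, hb, hb'⟩ := hU.exists_sqrt_eq z.snd.fst
    obtain ⟨c, hc, hc'⟩ := hT.exists_sqrt_eq z.snd.snd
    have e1 : ⟪z.fst, z.snd.fst⟫_ℝ ≤ p * ‖a‖ * ‖b‖ := by
      rw [← ha, ← hb, hS.inner_sqrt_comm]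
      refine (real_inner_le_norm _ _).trans ?_
      have := (hS.sqrt ∘L hU.sqrt).le_opNorm b
      calc _ ≤ ‖a‖ * (p * ‖b‖) := mul_le_mul_of_nonneg_left this (norm_nonneg _)
        _ = _ := by ring
    have e2 : ⟪K z.fst, z.snd.snd⟫_ℝ ≤ q * ‖a‖ * ‖c‖ := by
      rw [← ContinuousLinearMap.adjoint_inner_right, ← ha, ← hc, hS.inner_sqrt_comm]
      refine (real_inner_le_norm _ _).trans ?_
      have := (hS.sqrt ∘L K.adjoint ∘L hT.sqrt).le_opNorm c
      calc _ ≤ ‖a‖ * (q * ‖c‖) := mul_le_mul_of_nonneg_left this (norm_nonneg _)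
        _ = _ := by ring
    have e3 : ⟪preconditioner K S U T z, z⟫_ℝ = ‖a‖ ^ 2 + ‖b‖ ^ 2 + ‖c‖ ^ 2 -
        2 * ⟪z.fst, z.snd.fst⟫_ℝ - 2 * ⟪K z.fst, z.snd.snd⟫_ℝ := by
      rw [PrimalDual.inner_eq, ha', hb', hc']
      simp only [preconditioner_fst, preconditioner_snd_fst, preconditioner_snd_snd,
        inner_sub_left, ContinuousLinearMap.adjoint_inner_left]
      rw [real_inner_comm z.fst z.snd.fst, real_inner_comm (K z.fst) z.snd.snd]
      ring
    have e4 : min c₁ (min c₂ c₃) * ‖z‖ ^ 2 ≤ ‖a‖ ^ 2 + ‖b‖ ^ 2 + ‖c‖ ^ 2 := by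
      rw [PrimalDual.norm_sq_eq, mul_add, mul_add, ha', hb', hc', ← add_assoc]
      refine add_le_add (add_le_add (le_trans ?_ (h₁ _)) (le_trans ?_ (h₂ _)))
        (le_trans ?_ (h₃ _)) <;> refine mul_le_mul_of_nonneg_right ?_ (sq_nonneg _)
      · exact min_le_left _ _
      · exact (min_le_right _ _).trans (min_le_left _ _)
      · exact (min_le_right _ _).trans (min_le_right _ _)
    have e5 := add_sq_sub_ge (A := ‖a‖) (B := ‖b‖) (C := ‖c‖) hκ0 hκpq
    have e6 := mul_le_mul_of_nonneg_left e4 hκ1.le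
    rw [e3, mul_assoc]
    linarith

/-- `g` belongs to the value at `z` of the monotone operator
`(x, y, v) ↦ (∂H x + y + K* v, ∂G* y - x, ∂F* v - K x)`. -/
structure IsInclusion (z g : PrimalDual X Y) : Prop where
  sub_H : IsSubgradient H z.fst (g.fst - z.snd.fst - K.adjoint z.snd.snd)
  sub_G : IsSubgradient (fenchelConj G) z.snd.fst (g.snd.fst + z.fst)
  sub_F : IsSubgradient (fenchelConj F) z.snd.snd (g.snd.snd + K z.fst)

variable {K F G H}

/-- The coupling terms form a skew operator and cancel, leaving the monotonicity of three
subdifferentials. -/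
theorem IsInclusion.monotone {z g z' g' : PrimalDual X Y} (h : IsInclusion K F G H z g)
    (h' : IsInclusion K F G H z' g') : 0 ≤ ⟪g - g', z - z'⟫_ℝ := by
  have h1 := h.sub_H.monotone h'.sub_H
  have h2 := h.sub_G.monotone h'.sub_G
  have h3 := h.sub_F.monotone h'.sub_F
  rw [PrimalDual.inner_eq]
  simp only [WithLp.sub_fst, WithLp.sub_snd, inner_sub_left, inner_sub_right, inner_add_left,
    ContinuousLinearMap.adjoint_inner_left] at h1 h2 h3 ⊢
  have c1 := fun a b : X => real_inner_comm a b
  have c2 := fun a b : Y => real_inner_comm a b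
  rw [c1 z.fst z.snd.fst, c1 z'.fst z.snd.fst, c1 z.fst z'.snd.fst, c1 z'.fst z'.snd.fst,
    c2 (K z.fst) z.snd.snd, c2 (K z'.fst) z.snd.snd, c2 (K z.fst) z'.snd.snd,
    c2 (K z'.fst) z'.snd.snd] at h1
  linarith

theorem isInclusion_zero_iff (hF : GammaZero F) (hG : GammaZero G) {z : PrimalDual X Y} :
    IsInclusion K F G H z 0 ↔ IsKKT K F G H z.fst z.snd.fst z.snd.snd := by
  constructor
  · rintro ⟨h1, h2, h3⟩
    simp only [WithLp.zero_fst, WithLp.zero_snd, zero_sub, zero_add] at h1 h2 h3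
    exact ⟨h1, (isSubgradient_fenchelConj_iff hG).1 h2, (isSubgradient_fenchelConj_iff hF).1 h3⟩
  · rintro ⟨h1, h2, h3⟩
    refine ⟨?_, ?_, ?_⟩ <;> simp only [WithLp.zero_fst, WithLp.zero_snd, zero_sub, zero_add]
    exacts [h1, (isSubgradient_fenchelConj_iff hG).2 h2, (isSubgradient_fenchelConj_iff hF).2 h3]

variable (K F G H S U T)

/-- One step of the primal-dual fixed point algorithm without inertia and relaxation. -/
noncomputable def primalDualStep (z : PrimalDual X Y) : PrimalDual X Y :=
  let x' := prox S H (z.fst - S z.snd.fst - S (K.adjoint z.snd.snd))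
  let y' := prox U (fenchelConj G) (z.snd.fst + U ((2 : ℝ) • x' - z.fst))
  let v' := prox T (fenchelConj F) (z.snd.snd + T (K ((2 : ℝ) • x' - z.fst)))
  WithLp.toLp 2 (x', WithLp.toLp 2 (y', v'))

variable {K F G H S U T}

/-- The step is the resolvent `(M + A)⁻¹ M`. The extrapolation `2 x' - x` arises because the
off-diagonal terms of `M` contribute `x' - x` and the skew part of `A` another `x'`. -/
theorem primalDualStep_eq_iff (hF : GammaZero F) (hG : GammaZero G) (hH : GammaZero H)
    (hS : PosDef S) (hU : PosDef U) (hT : PosDef T) {z z' : PrimalDual X Y} :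
    primalDualStep K F G H S U T z = z' ↔
      IsInclusion K F G H z' (preconditioner K S U T (z - z')) := by
  have h1 : primalDualStep K F G H S U T z = z' ↔
      prox S H (z.fst - S z.snd.fst - S (K.adjoint z.snd.snd)) = z'.fst ∧
      prox U (fenchelConj G) (z.snd.fst + U ((2 : ℝ) • z'.fst - z.fst)) = z'.snd.fst ∧
      prox T (fenchelConj F) (z.snd.snd + T (K ((2 : ℝ) • z'.fst - z.fst))) = z'.snd.snd := by
    constructor
    · rintro rfl
      exact ⟨rfl, rfl, rfl⟩
    · rintro ⟨h1, h2, h3⟩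
      refine PrimalDual.ext h1 ?_ ?_
      · rw [← h1] at h2
        exact h2
      · rw [← h1] at h3
        exact h3
  rw [h1, prox_eq_iff hS hH, prox_eq_iff hU hG.fenchelConj, prox_eq_iff hT hF.fenchelConj]
  have e1 : Ring.inverse S (z.fst - S z.snd.fst - S (K.adjoint z.snd.snd) - z'.fst) =
      (preconditioner K S U T (z - z')).fst - z'.snd.fst - K.adjoint z'.snd.snd := by
    simp only [preconditioner_fst, WithLp.sub_fst, map_sub, hS.inverse_apply]
    abel
  have e2 : Ring.inverse U (z.snd.fst + U ((2 : ℝ) • z'.fst - z.fst) - z'.snd.fst) =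
      (preconditioner K S U T (z - z')).snd.fst + z'.fst := by
    rw [map_sub, map_add, hU.inverse_apply]
    simp only [preconditioner_snd_fst, WithLp.sub_fst, WithLp.sub_snd, map_sub]
    module
  have e3 : Ring.inverse T (z.snd.snd + T (K ((2 : ℝ) • z'.fst - z.fst)) - z'.snd.snd) =
      (preconditioner K S U T (z - z')).snd.snd + K z'.fst := by
    rw [map_sub, map_add, hT.inverse_apply]
    simp only [preconditioner_snd_snd, WithLp.sub_snd, map_sub, map_smul]
    module
  rw [e1, e2, e3]
  exact ⟨fun h => ⟨h.1, h.2.1, h.2.2⟩, fun h => ⟨h.sub_H, h.sub_G, h.sub_F⟩⟩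

/-- With `b` the difference of the images, monotonicity gives `⟪M b, b⟫ ≤ ⟪M (z - w), b⟫`, and
positivity of `M` at `z - w - b` absorbs the mixed term. -/
theorem primalDualStep_nonexpansive (hF : GammaZero F) (hG : GammaZero G) (hH : GammaZero H)
    (hS : PosDef S) (hU : PosDef U) (hT : PosDef T) (hM : PosDef (preconditioner K S U T))
    (z w : PrimalDual X Y) :
    ⟪preconditioner K S U T (primalDualStep K F G H S U T z - primalDualStep K F G H S U T w),
      primalDualStep K F G H S U T z - primalDualStep K F G H S U T w⟫_ℝ ≤
    ⟪preconditioner K S U T (z - w), z - w⟫_ℝ := by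
  have h1 := ((primalDualStep_eq_iff hF hG hH hS hU hT).1 rfl).monotone
    ((primalDualStep_eq_iff (z := w) (K := K) hF hG hH hS hU hT).1 rfl)
    (z := primalDualStep K F G H S U T z) (z' := primalDualStep K F G H S U T w)
  set M := preconditioner K S U T
  set b := primalDualStep K F G H S U T z - primalDualStep K F G H S U T w with hb
  have h2 : M (z - primalDualStep K F G H S U T z) - M (w - primalDualStep K F G H S U T w) =
      M (z - w) - M b := by
    rw [← map_sub, ← map_sub, hb]
    congr 1
    abel
  rw [h2, inner_sub_left] at h1
  have h3 := hM.inner_nonneg (z - w - b)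
  have h4 : ⟪M b, z - w⟫_ℝ = ⟪M (z - w), b⟫_ℝ := by
    rw [hM.inner_map_comm, real_inner_comm]
  rw [map_sub, inner_sub_left, inner_sub_right _ (z - w), inner_sub_right _ (z - w), h4] at h3
  linarith

theorem primalDualStep_eq_self_iff (hF : GammaZero F) (hG : GammaZero G) (hH : GammaZero H)
    (hS : PosDef S) (hU : PosDef U) (hT : PosDef T) {z : PrimalDual X Y} :
    primalDualStep K F G H S U T z = z ↔ IsKKT K F G H z.fst z.snd.fst z.snd.snd := by
  rw [primalDualStep_eq_iff hF hG hH hS hU hT, sub_self, map_zero, isInclusion_zero_iff hF hG]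

end

theorem WeaklyConvergesTo.tendsto {E : Type*} [NormedAddCommGroup E] [InnerProductSpace ℝ E]
    [FiniteDimensional ℝ E] {x : ℕ → E} {a : E} (h : WeaklyConvergesTo x a) :
    Tendsto x atTop (𝓝 a) := by
  have h1 : ∀ z : E, z = ∑ i, ⟪z, stdOrthonormalBasis ℝ E i⟫_ℝ • stdOrthonormalBasis ℝ E i := by
    intro z
    conv_lhs => rw [← (stdOrthonormalBasis ℝ E).sum_repr' z]
    exact Finset.sum_congr rfl fun i _ => by rw [real_inner_comm]
  rw [h1 a, funext fun k => h1 (x k)]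
  exact tendsto_finsetSum _ fun i _ => (h _).smul_const _

end IPDFP

/-! ### The convergence theorem -/

theorem theorem4p1 {X Y : Type*}
    [NormedAddCommGroup X] [InnerProductSpace ℝ X] [CompleteSpace X]
    [NormedAddCommGroup Y] [InnerProductSpace ℝ Y] [CompleteSpace Y]
    (K : X →L[ℝ] Y) (F : Y → EReal) (G H : X → EReal)
    (hF : IPDFP.GammaZero F) (hG : IPDFP.GammaZero G) (hH : IPDFP.GammaZero H)
    -- the infimum of the problem is attained, and the qualification condition holds
    (hsol : ∃ x, IPDFP.IsSolution K F G H x)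
    (hqual : IPDFP.Qualification K F G H)
    -- the preconditioners
    (S U : X →L[ℝ] X) (T : Y →L[ℝ] Y)
    (hS : IPDFP.PosDef S) (hU : IPDFP.PosDef U) (hT : IPDFP.PosDef T)
    (hnorm : ‖hS.sqrt ∘L hU.sqrt‖ ^ 2 + ‖hS.sqrt ∘L K.adjoint ∘L hT.sqrt‖ ^ 2 < 1)
    -- the inertial and relaxation parameters
    (α ρ : ℕ → ℝ) (αmax ρmin θ δ : ℝ)
    (hα_one : α 1 = 0)
    (hα_mono : ∀ k, 1 ≤ k → α k ≤ α (k + 1))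
    (hα_bound : ∀ k, 1 ≤ k → 0 ≤ α k ∧ α k ≤ αmax)
    (hαmax : αmax < 1)
    (hρmin : 0 < ρmin) (hθ : 0 < θ) (hδ : 0 < δ)
    (hδ_bound : (αmax ^ 2 * (1 + αmax) + αmax * θ) / (1 - αmax ^ 2) < δ)
    (hρ : ∀ k, 1 ≤ k → ρmin ≤ ρ k ∧
      ρ k < (δ - αmax * (αmax * (1 + αmax) + αmax * δ + θ)) /
        (δ * (1 + αmax * (1 + αmax) + αmax * δ + θ)))
    -- the iterates, from arbitrary initial points
    (x y : ℕ → X) (v : ℕ → Y)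
    (hgen : IPDFP.Generated K F G H S U T α ρ x y v) :
    ∃ xsol, IPDFP.IsSolution K F G H xsol ∧ IPDFP.WeaklyConvergesTo x xsol ∧
      (FiniteDimensional ℝ X → Tendsto x atTop (𝓝 xsol)) := by
  obtain ⟨u, hu⟩ := hsol
  obtain ⟨yu, vu, hkkt⟩ := IPDFP.exists_isKKT hF hG hH hqual hu
  have hM := IPDFP.posDef_preconditioner K hS hU hT hnorm
  obtain ⟨z, hz, hlim⟩ := hM.exists_weak_limit_inertial
    (IPDFP.primalDualStep_nonexpansive hF hG hH hS hU hT hM)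
    ⟨WithLp.toLp 2 (u, WithLp.toLp 2 (yu, vu)),
      (IPDFP.primalDualStep_eq_self_iff hF hG hH hS hU hT).2 hkkt⟩
    -- The parameters start at index `1`; after the shift `α 1 = 0` becomes the vanishing initial
    -- inertia.
    (a := fun k => α (k + 1)) (ρ := fun k => ρ (k + 1)) hα_one
    (monotone_nat_of_le_succ fun k => hα_mono (k + 1) (Nat.le_add_left 1 k))
    (fun k => (hα_bound (k + 1) (Nat.le_add_left 1 k)).2) hαmax hρmin hθ hδ
    (fun k => (hρ (k + 1) (Nat.le_add_left 1 k)).1)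
    (fun k => (hρ (k + 1) (Nat.le_add_left 1 k)).2)
    (x := fun k => WithLp.toLp 2 (x k, WithLp.toLp 2 (y k, v k)))
    (fun k => by
      obtain ⟨h1, h2, h3⟩ := hgen (k + 1) (Nat.le_add_left 1 k)
      exact IPDFP.PrimalDual.ext h1 h2 h3)
  -- Testing against `(w, 0, 0)` isolates the primal component, so norm convergence needs only `X`
  -- to be finite-dimensional.
  have hweak : IPDFP.WeaklyConvergesTo x z.fst := fun w => by
    simpa [IPDFP.PrimalDual.inner_eq] using hlim (WithLp.toLp 2 (w, 0))
  exact ⟨z.fst, ((IPDFP.primalDualStep_eq_self_iff hF hG hH hS hU hT).1 hz).isSolution hF hG hH,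
    hweak, fun _ => hweak.tendsto⟩
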